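/- Work over the field $\mathbb{C}(q)$ and put $[m]:=(q^{m}-q^{-m})/(q-q^{-1})$ for $m\in\mathbb{Z}$. For $n\ge 0$ let $\mathrm{TL}^{D}_{n+1}$ be the Temperley--Lieb algebra of type $D_{n+1}$: the unital associative $\mathbb{C}(q)$-algebra with generators $E_0,E_1,\ldots,E_n$ and relations $E_i^2=-[2]E_i$ for all $i$; $E_iE_jE_i=E_i$ if $i$ and $j$ are adjacent; $E_iE_j=E_jE_i$ if $i$ and $j$ are not adjacent. Here the nodes $0$ and $1$ are each adjacent to $2$ (and not to each other), $k$ is adjacent to $k+1$ for $2\le k\le n-1$, and there are no other adjacencies. For $m\le n$, elements of $\mathrm{TL}^{D}_{m+1}$ are regarded in $\mathrm{TL}^{D}_{n+1}$ via the homomorphism $E_i\mapsto E_i$. A word $E_{s_1}\cdots E_{s_l}$ is called reduced if it is not, up to a scalar factor, a product of fewer than $l$ generators. The coefficient of a reduced word $D$ in an element $x$ is the coefficient of $D$ when $x$ is written as a linear combination of the distinct elements of $\mathrm{TL}^{D}_{n+1}$ that are given by reduced words. Let $Q_n\in\mathrm{TL}^{D}_{n+1}$, $n\ge0$, be the Jones--Wenzl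 projections of type $D$, that is, the unique family of elements such that, for all $n\ge 0$: $Q_n\neq0$; $Q_nQ_i=Q_iQ_n=Q_n$ for $0\le i\le n$; and $E_iQ_n=Q_nE_i=0$ for $0\le i\le n$. **Proposition.** The family $(Q_n)_{n\ge0}$ exists and is unique, and the following hold. (1) For all integers $n,i,j$ with $1\le j\le n$ and $2\le i\le n$, the word $D=E_jE_{j-1}\cdots E_1E_0E_2E_3\cdots E_i$ is reduced, and its coefficient in $Q_n$ is well defined and equal to $$\frac{[n]\,[n+1-i]\,[n+1-j]}{[2n]\,[n+1]}.$$ (2) For all $n\ge1$, the word $E_0E_1$ is reduced, and its coefficient in $Q_n$ is well defined and equal to $$\frac{[n]^{3}}{[2n]\,[n+1]}.$$ -/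

import Mathlib

noncomputable section

namespace TLTypeD

/-- The base field `ℂ(q)`. -/
abbrev K : Type := RatFunc ℂ

/-- The `q`-integer `[m] = (q ^ m - q ^ (-m)) / (q - q⁻¹)` in `ℂ(q)`, for `m : ℤ`. -/
def qint (m : ℤ) : K :=
  ((RatFunc.X : K) ^ m - (RatFunc.X : K) ^ (-m)) / ((RatFunc.X : K) - (RatFunc.X : K)⁻¹)

/-- Adjacency in the Dynkin diagram of type `D` with nodes `0, 1, 2, …`: the nodes `0` and `1` are
both joined to `2`, and `k` is joined to `k + 1` for `k ≥ 1`. -/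
def DynkinAdj (i j : ℕ) : Prop :=
  (1 ≤ i ∧ j = i + 1) ∨ (1 ≤ j ∧ i = j + 1) ∨ (i = 0 ∧ j = 2) ∨ (i = 2 ∧ j = 0)

/-- The defining relations of the Temperley--Lieb algebra of type `D` of rank `n + 1`, on the free
algebra with generators labelled `0, …, n`. -/
inductive Rel (n : ℕ) : FreeAlgebra K (Fin (n + 1)) → FreeAlgebra K (Fin (n + 1)) → Prop
  | sq (i : Fin (n + 1)) :
      Rel n (FreeAlgebra.ι K i * FreeAlgebra.ι K i) ((-qint 2) • FreeAlgebra.ι K i)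
  | braid (i j : Fin (n + 1)) (h : DynkinAdj i j) :
      Rel n (FreeAlgebra.ι K i * FreeAlgebra.ι K j * FreeAlgebra.ι K i) (FreeAlgebra.ι K i)
  | comm (i j : Fin (n + 1)) (h : ¬ DynkinAdj i j) :
      Rel n (FreeAlgebra.ι K i * FreeAlgebra.ι K j) (FreeAlgebra.ι K j * FreeAlgebra.ι K i)

/-- The Temperley--Lieb algebra of type `D` of rank `n + 1`, over `ℂ(q)`. -/
abbrev TLD (n : ℕ) : Type := RingQuot (Rel n)

/-- The generator `E_i`, `0 ≤ i ≤ n`. -/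
def E (n : ℕ) (i : Fin (n + 1)) : TLD n :=
  RingQuot.mkAlgHom K (Rel n) (FreeAlgebra.ι K i)

theorem E_sq (n : ℕ) (i : Fin (n + 1)) : E n i * E n i = (-qint 2) • E n i := by
  have h := RingQuot.mkAlgHom_rel K (Rel.sq i)
  rwa [map_mul, map_smul] at h

theorem E_braid (n : ℕ) (i j : Fin (n + 1)) (hij : DynkinAdj i j) :
    E n i * E n j * E n i = E n i := by
  have h := RingQuot.mkAlgHom_rel K (Rel.braid i j hij)
  rwa [map_mul, map_mul] at h

theorem E_comm (n : ℕ) (i j : Fin (n + 1)) (hij : ¬ DynkinAdj i j) :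
    E n i * E n j = E n j * E n i := by
  have h := RingQuot.mkAlgHom_rel K (Rel.comm i j hij)
  rwa [map_mul, map_mul] at h

/-- The natural homomorphism from the algebra of rank `m + 1` to the algebra of rank `n + 1`,
`m ≤ n`, sending `E_i` to `E_i`. -/
def incl {m n : ℕ} (h : m ≤ n) : TLD m →ₐ[K] TLD n :=
  RingQuot.liftAlgHom K
    ⟨FreeAlgebra.lift K (fun i : Fin (m + 1) => E n (Fin.castLE (Nat.succ_le_succ h) i)), by
      intro x y hxy
      cases hxy with
      | sq i =>
        rw [map_mul, map_smul, FreeAlgebra.lift_ι_apply]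
        exact E_sq n _
      | braid i j hij =>
        simp only [map_mul, FreeAlgebra.lift_ι_apply]
        exact E_braid n _ _ hij
      | comm i j hij =>
        simp only [map_mul, FreeAlgebra.lift_ι_apply]
        exact E_comm n _ _ hij⟩

/-- The element `E_w = E_{s_1} ⋯ E_{s_l}` of a word `w = (s_1, …, s_l)`. -/
def word (n : ℕ) (w : List (Fin (n + 1))) : TLD n := (w.map (E n)).prod

/-- The word `w` is a reduced expression: `E_w` is not, up to a scalar factor, a product of fewer
generators. -/
def IsReduced (n : ℕ) (w : List (Fin (n + 1))) : Prop :=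
  ∀ (w' : List (Fin (n + 1))) (c : K), word n w = c • word n w' → w.length ≤ w'.length

/-- The set of the elements `E_w`, `w` a reduced expression (the monomial, or diagram, basis). -/
def monomials (n : ℕ) : Set (TLD n) := {x | ∃ w, IsReduced n w ∧ word n w = x}

/-- `a` is the coefficient of the reduced monomial `D` in `x`: the element `x` is a linear
combination of reduced monomials, and `D` has coefficient `a` in every such combination. -/
def HasCoeff (n : ℕ) (x D : TLD n) (a : K) : Prop :=
  D ∈ monomials n ∧ x ∈ Submodule.span K (monomials n) ∧
    ∀ c : TLD n →₀ K, (∀ b ∈ c.support, b ∈ monomials n) → (c.sum fun b r => r • b) = x → c D = a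

/-- The family `Q_0, Q_1, Q_2, …` consists of the Jones--Wenzl projections of type `D`. -/
structure IsJonesWenzl (Q : ∀ n : ℕ, TLD n) : Prop where
  ne_zero : ∀ n, Q n ≠ 0
  mul_incl : ∀ (n m : ℕ) (h : m ≤ n), Q n * incl h (Q m) = Q n
  incl_mul : ∀ (n m : ℕ) (h : m ≤ n), incl h (Q m) * Q n = Q n
  E_mul : ∀ (n : ℕ) (i : Fin (n + 1)), E n i * Q n = 0
  mul_E : ∀ (n : ℕ) (i : Fin (n + 1)), Q n * E n i = 0

/-- The word `(j, j - 1, …, 1, 0, 2, 3, …, i)` in the labels `0, …, n`. -/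
def wordD (n j i : ℕ) : List (Fin (n + 1)) :=
  ((List.finRange (n + 1)).filter fun k => 1 ≤ k.val ∧ k.val ≤ j).reverse ++
    0 :: (List.finRange (n + 1)).filter fun k => 2 ≤ k.val ∧ k.val ≤ i

end TLTypeD

end

/-! An element killed on the left by all generators satisfies `x * Q = aug x • Q`, where the
augmentation `aug` kills every `E_i`; the mirror statement holds on the right. So the Jones–Wenzl
conditions amount to left annihilation together with augmentation `1`, and two families agree by
computing `Q n * Q' n` in two ways.

For existence when `n ≥ 2`, correct the previous projection `Q` by products `b_j Q` and `c_j Q`.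
Here `b_j` is the product of generators along the Dynkin path from `j` to `n`, and `c_j = E_j ⋯ E_1
E_0 E_2 ⋯ E_n`. Left multiplication by `E_k` acts on the `b_j Q` by the negative `q`-Cartan matrix
of type `D` and on the `c_j Q` by that of type `A`, with one coupling: `E_0 b_1 = E_1 b_0 = c_1`.
Annihilation becomes a linear system with explicit solution `solB`, `solC`
(`apply_solution_eq_zero`, `mul_nextProjection_eq_zero`).

The same formulas, with an arbitrary end node `i`, define a module with basis `v`, `b_j`, `c_j`
(`cupRep`). Its vector `u = v + ∑ solB b_j + ∑ solC c_j` is killed by all generators, so `Q u = u`.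
But `Q` kills each `b_j` and `c_j`, which are multiples of their images under a generator. Hence `Q
v = u`, and the `c_j`-coordinate of `Q v` is `solC n i j`, the asserted value.

That coordinate is a linear functional which is `1` on `D` and `0` on every other reduced monomial.
Indeed a word sends `v` to zero or to a multiple of a basis vector. If it reaches `s c_j`, it equals
`s D` in the algebra and has length at least `i + j`, with `s = 1` in case of equality (`Reaches`).
This shows that `D` is reduced and that its coefficient is well defined, without proving that the
reduced monomials are linearly independent. The word `E_0 E_1` is the case `i = j = 1`. -/

noncomputable section

namespace TLTypeD

/-! ### Quantum integers -/

/-- The element `q ^ m + q ^ (-m)` of `ℂ(q)`. -/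
def qsum (m : ℤ) : K := (RatFunc.X : K) ^ m + (RatFunc.X : K) ^ (-m)

/-- Comparing degrees: `q` is not a root of unity. The nonvanishing of all denominators rests on
this. -/
theorem ratFuncX_pow_ne_one {m : ℕ} (hm : m ≠ 0) : (RatFunc.X : K) ^ m ≠ 1 := by
  intro h
  rw [← RatFunc.algebraMap_X, ← map_pow, ← map_one (algebraMap (Polynomial ℂ) K)] at h
  have h' := congrArg Polynomial.natDegree (RatFunc.algebraMap_injective ℂ h)
  rw [Polynomial.natDegree_X_pow, Polynomial.natDegree_one] at h'
  exact hm h'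

theorem X_ne_zero : (RatFunc.X : K) ≠ 0 := RatFunc.X_ne_zero

theorem zpow_sub_zpow_neg_ne_zero {m : ℕ} (hm : m ≠ 0) :
    (RatFunc.X : K) ^ (m : ℤ) - (RatFunc.X : K) ^ (-(m : ℤ)) ≠ 0 := by
  intro h
  apply ratFuncX_pow_ne_one (m := m + m) (by omega)
  have hX := X_ne_zero
  rw [zpow_neg, zpow_natCast, sub_eq_zero] at h
  rw [pow_add]
  nth_rewrite 1 [h]
  exact inv_mul_cancel₀ (pow_ne_zero _ hX)

theorem X_sub_inv_ne_zero : (RatFunc.X : K) - (RatFunc.X : K)⁻¹ ≠ 0 := by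
  simpa using zpow_sub_zpow_neg_ne_zero (m := 1) one_ne_zero

theorem qint_ne_zero {m : ℕ} (hm : m ≠ 0) : qint m ≠ 0 :=
  div_ne_zero (zpow_sub_zpow_neg_ne_zero hm) X_sub_inv_ne_zero

theorem qint_zero : qint 0 = 0 := by simp [qint]

theorem qint_one : qint 1 = 1 := by
  simpa [qint] using div_self X_sub_inv_ne_zero

theorem qsum_zero : qsum 0 = 2 := by simp [qsum]; norm_num

theorem qint_two_mul (m : ℤ) : qint (2 * m) = qint m * qsum m := by
  have hX := X_ne_zero
  have : (RatFunc.X : K) ^ m ≠ 0 := zpow_ne_zero _ hX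
  rw [qint, qint, qsum, two_mul, neg_add, zpow_add₀ hX, zpow_add₀ hX, zpow_neg]
  ring

theorem qint_two : qint 2 = RatFunc.X + (RatFunc.X : K)⁻¹ := by
  have h := qint_two_mul 1
  rw [qint_one, one_mul, mul_one] at h
  rw [h, qsum, zpow_neg, zpow_one]

theorem qsum_one : qsum 1 = qint 2 := by
  rw [qint_two, qsum, zpow_neg, zpow_one]

theorem qint_two_ne_zero : qint 2 ≠ 0 := qint_ne_zero (m := 2) two_ne_zero

theorem qsum_ne_zero {n : ℕ} (hn : n ≠ 0) : qsum n ≠ 0 := by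
  have h := qint_ne_zero (m := 2 * n) (by omega)
  push_cast at h
  rw [qint_two_mul] at h
  exact right_ne_zero_of_mul h

/-- This and `qsum_rec` are the homogeneous rows of the Cartan systems, away from the branch node
and the source term. -/
theorem qint_rec (m : ℤ) : qint 2 * qint (m + 1) = qint (m + 2) + qint m := by
  have hX := X_ne_zero
  have : (RatFunc.X : K) ^ m ≠ 0 := zpow_ne_zero _ hX
  rw [qint_two, qint, qint, qint, show m + 2 = m + 1 + 1 by ring]
  simp only [neg_add, zpow_add₀ hX, zpow_neg, zpow_one]
  field_simp
  ring

theorem qsum_rec (m : ℤ) : qint 2 * qsum (m + 1) = qsum (m + 2) + qsum m := by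
  have hX := X_ne_zero
  have : (RatFunc.X : K) ^ m ≠ 0 := zpow_ne_zero _ hX
  rw [qint_two, qsum, qsum, qsum, show m + 2 = m + 1 + 1 by ring]
  simp only [neg_add, zpow_add₀ hX, zpow_neg, zpow_one]
  field_simp
  ring

/-- A Casoratian-type identity for the two solutions of the recurrence. At the source row it
produces `qsum n`, which is why `qsum n` is the normalising denominator of `solB`. -/
theorem qsum_mul_qint_sub (i m : ℤ) :
    qsum (i + 1) * qint (m + 1) - qsum i * qint m = qsum (i + m + 1) := by
  have hX := X_ne_zero
  have h1 : (RatFunc.X : K) ^ m ≠ 0 := zpow_ne_zero _ hX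
  have h2 : (RatFunc.X : K) ^ i ≠ 0 := zpow_ne_zero _ hX
  have h3 := X_sub_inv_ne_zero
  rw [qint, qint, qsum, qsum, qsum, mul_div_assoc', mul_div_assoc', ← sub_div, div_eq_iff h3]
  simp only [neg_add, zpow_add₀ hX, zpow_neg, zpow_one]
  field_simp
  ring

/-! ### The `q`-Cartan matrices and a linear system -/

open Classical in
/-- The negative of the `q`-Cartan matrix of type `D`. -/
def cartD (k j : ℕ) : K := if j = k then -qint 2 else if DynkinAdj k j then 1 else 0

/-- The negative of the `q`-Cartan matrix of type `A`. -/
def cartA (k j : ℕ) : K := if j = k then -qint 2 else if j = k + 1 ∨ k = j + 1 then 1 else 0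

/-- The boundary convention `f (n + 1) = 0` gives the row of the last node the same shape as the
others, so small `n` need no separate formula. The following row lemmas use it in the same way. -/
theorem sum_cartD_zero {n : ℕ} (hn : 1 ≤ n) {f : ℕ → K} (hf : f (n + 1) = 0) :
    ∑ j ∈ Finset.range (n + 1), cartD 0 j * f j = -qint 2 * f 0 + f 2 := by
  have h : ∀ j, cartD 0 j * f j =
      (if j = 0 then -qint 2 * f j else 0) + (if j = 2 then f j else 0) := by
    intro j
    unfold cartD DynkinAdj
    split_ifs <;> first | omega | (simp; done) | (simp at *; omega)
  simp only [h, Finset.sum_add_distrib, Finset.sum_ite_eq', Finset.mem_range]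
  rcases Nat.lt_or_ge 1 n with h1 | h1
  · rw [if_pos (by omega), if_pos (by omega)]
  · obtain rfl : n = 1 := by omega
    simp [hf]

theorem sum_cartD_one {n : ℕ} (hn : 1 ≤ n) {f : ℕ → K} (hf : f (n + 1) = 0) :
    ∑ j ∈ Finset.range (n + 1), cartD 1 j * f j = -qint 2 * f 1 + f 2 := by
  have h : ∀ j, cartD 1 j * f j =
      (if j = 1 then -qint 2 * f j else 0) + (if j = 2 then f j else 0) := by
    intro j
    unfold cartD DynkinAdj
    split_ifs <;> first | omega | simp
  simp only [h, Finset.sum_add_distrib, Finset.sum_ite_eq', Finset.mem_range]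
  rcases Nat.lt_or_ge 1 n with h1 | h1
  · rw [if_pos (by omega), if_pos (by omega)]
  · obtain rfl : n = 1 := by omega
    simp [hf]

theorem sum_cartD_two {n : ℕ} (hn : 2 ≤ n) {f : ℕ → K} (hf : f (n + 1) = 0) :
    ∑ j ∈ Finset.range (n + 1), cartD 2 j * f j = -qint 2 * f 2 + f 0 + f 1 + f 3 := by
  have h : ∀ j, cartD 2 j * f j =
      (if j = 2 then -qint 2 * f j else 0) + (if j = 0 then f j else 0) +
        (if j = 1 then f j else 0) + (if j = 3 then f j else 0) := by
    intro j
    unfold cartD DynkinAdj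
    split_ifs <;> first | omega | simp
  simp only [h, Finset.sum_add_distrib, Finset.sum_ite_eq', Finset.mem_range]
  rw [if_pos (by omega), if_pos (by omega), if_pos (by omega)]
  rcases Nat.lt_or_ge 2 n with h1 | h1
  · rw [if_pos (by omega)]
  · obtain rfl : n = 2 := by omega
    simp [hf]

theorem sum_cartD_add_three {n m : ℕ} (hm : m + 3 ≤ n) {f : ℕ → K} (hf : f (n + 1) = 0) :
    ∑ j ∈ Finset.range (n + 1), cartD (m + 3) j * f j =
      -qint 2 * f (m + 3) + f (m + 2) + f (m + 4) := by
  have h : ∀ j, cartD (m + 3) j * f j =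
      (if j = m + 3 then -qint 2 * f j else 0) + (if j = m + 2 then f j else 0) +
        (if j = m + 4 then f j else 0) := by
    intro j
    unfold cartD DynkinAdj
    split_ifs <;> first | omega | (simp; done) | (simp at *; omega)
  simp only [h, Finset.sum_add_distrib, Finset.sum_ite_eq', Finset.mem_range]
  rw [if_pos (by omega), if_pos (by omega)]
  rcases Nat.lt_or_ge (m + 3) n with h1 | h1
  · rw [if_pos (by omega)]
  · obtain rfl : n = m + 3 := by omega
    simp [hf]

theorem sum_cartA_one {n : ℕ} (hn : 1 ≤ n) {f : ℕ → K} (hf : f (n + 1) = 0) :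
    ∑ j ∈ Finset.Icc 1 n, cartA 1 j * f j = -qint 2 * f 1 + f 2 := by
  have h : ∀ j ∈ Finset.Icc 1 n, cartA 1 j * f j =
      (if j = 1 then -qint 2 * f j else 0) + (if j = 2 then f j else 0) := by
    intro j hj
    rw [Finset.mem_Icc] at hj
    unfold cartA
    split_ifs <;> first | omega | simp
  rw [Finset.sum_congr rfl h]
  simp only [Finset.sum_add_distrib, Finset.sum_ite_eq', Finset.mem_Icc]
  rw [if_pos (by omega)]
  rcases Nat.lt_or_ge 1 n with h1 | h1
  · rw [if_pos (by omega)]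
  · obtain rfl : n = 1 := by omega
    simp [hf]

theorem sum_cartA_add_two {n m : ℕ} (hm : m + 2 ≤ n) {f : ℕ → K} (hf : f (n + 1) = 0) :
    ∑ j ∈ Finset.Icc 1 n, cartA (m + 2) j * f j =
      -qint 2 * f (m + 2) + f (m + 1) + f (m + 3) := by
  have h : ∀ j, cartA (m + 2) j * f j =
      (if j = m + 2 then -qint 2 * f j else 0) + (if j = m + 1 then f j else 0) +
        (if j = m + 3 then f j else 0) := by
    intro j
    unfold cartA
    split_ifs <;> first | omega | simp
  simp only [h, Finset.sum_add_distrib, Finset.sum_ite_eq', Finset.mem_Icc]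
  rw [if_pos (by omega), if_pos (by omega)]
  rcases Nat.lt_or_ge (m + 2) n with h1 | h1
  · rw [if_pos (by omega)]
  · obtain rfl : n = m + 2 := by omega
    simp [hf]

/-- The coefficients of the one-cup diagrams without a decorated loop. -/
def solB (n i j : ℕ) : K :=
  if j ≤ 1 then qint ((n : ℤ) + 1 - i) / qsum n
  else if j ≤ i then qsum ((j : ℤ) - 1) * qint ((n : ℤ) + 1 - i) / qsum n
  else qsum ((i : ℤ) - 1) * qint ((n : ℤ) + 1 - j) / qsum n

/-- The coefficients of the one-cup diagrams with a decorated loop. -/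
def solC (n i j : ℕ) : K :=
  qint ((n : ℤ) + 1 - j) * qint ((n : ℤ) + 1 - i) / (qint ((n : ℤ) + 1) * qsum n)

theorem solB_last {n i : ℕ} (hn : 1 ≤ n) (hi : i ≤ n) : solB n i (n + 1) = 0 := by
  rw [solB, if_neg (by omega), if_neg (by omega)]
  simp [qint_zero]

theorem solC_last (n i : ℕ) : solC n i (n + 1) = 0 := by
  simp [solC, qint_zero]

/-- Since `qsum 0 = 2`, the values at the twin nodes `0` and `1` are half of what the formula for `j
≥ 2` would give at `j = 1`. For `i = 1` both twin nodes carry a source. -/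
theorem solB_system_le_one {n i : ℕ} (hn : 1 ≤ n) (h1 : 1 ≤ i) (hi : i ≤ n) :
    -qint 2 * solB n i 1 + solB n i 2 + (if i = 1 then 1 else 0) = 0 := by
  have hW : qsum n ≠ 0 := qsum_ne_zero (by omega)
  rw [solB, solB, if_pos le_rfl, if_neg (by omega)]
  rcases Nat.lt_or_ge 1 i with h | h
  · rw [if_pos (by omega), if_neg (by omega)]
    push_cast
    norm_num
    rw [qsum_one]
    ring
  · obtain rfl : i = 1 := by omega
    rw [if_neg (by omega), if_pos rfl]
    have e1 := qint_rec ((n : ℤ) - 1)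
    have e2 := qsum_mul_qint_sub 0 ((n : ℤ) - 1)
    have e3 := qsum_zero
    have e4 := qsum_one
    push_cast
    simp only [zero_add, sub_add_cancel, add_sub_cancel_right,
      show (n : ℤ) + 1 - 2 = n - 1 by ring] at *
    rw [e3, ← e2, e4, e3]
    rw [← e2, e4, e3] at hW
    field_simp
    ring

theorem solB_system_two {n i : ℕ} (hn : 2 ≤ n) (h1 : 1 ≤ i) (hi : i ≤ n) :
    -qint 2 * solB n i 2 + solB n i 0 + solB n i 1 + solB n i 3 +
      (if i = 2 then 1 else 0) = 0 := by
  have hW : qsum n ≠ 0 := qsum_ne_zero (by omega)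
  have e3 := qsum_zero
  have e4 := qsum_one
  have e5 := qsum_rec 0
  simp only [solB, if_pos (Nat.zero_le 1), if_pos (le_refl 1), if_neg (show ¬ 2 ≤ 1 by omega),
    if_neg (show ¬ 3 ≤ 1 by omega)]
  push_cast
  norm_num at e5 ⊢
  rcases Nat.lt_trichotomy i 2 with h | rfl | h
  · obtain rfl : i = 1 := by omega
    have e1 := qint_rec ((n : ℤ) - 2)
    norm_num at e1 ⊢
    simp only [show (n : ℤ) + 1 - 2 = n - 1 by ring, show (n : ℤ) + 1 - 3 = n - 2 by ring,
      show (n : ℤ) - 2 + 1 = n - 1 by ring] at *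
    rw [e3]
    linear_combination (-2 / qsum n) * e1
  · have e2 := qsum_mul_qint_sub 1 ((n : ℤ) - 2)
    norm_num at e2 ⊢
    simp only [show (n : ℤ) + 1 - 2 = n - 1 by ring, show (n : ℤ) + 1 - 3 = n - 2 by ring,
      show (n : ℤ) - 2 + 1 = n - 1 by ring, show 1 + ((n : ℤ) - 2) + 1 = n by ring] at *
    field_simp
    rw [e3] at e5
    linear_combination (-qint ((n : ℤ) - 1)) * e5 - e2
  · rw [if_pos (by omega), if_pos (by omega), if_neg (by omega)]
    rw [e3] at e5
    linear_combination (-qint ((n : ℤ) + 1 - i) / qsum n) * e5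

theorem solB_system_add_three {n i m : ℕ} (hm : m + 3 ≤ n) (h1 : 1 ≤ i) :
    -qint 2 * solB n i (m + 3) + solB n i (m + 2) + solB n i (m + 4) +
      (if i = m + 3 then 1 else 0) = 0 := by
  have hW : qsum n ≠ 0 := qsum_ne_zero (by omega)
  simp only [solB, if_neg (show ¬ m + 3 ≤ 1 by omega), if_neg (show ¬ m + 2 ≤ 1 by omega),
    if_neg (show ¬ m + 4 ≤ 1 by omega)]
  push_cast
  have e1 := qsum_rec ((m : ℤ) + 1)
  rcases Nat.lt_trichotomy i (m + 3) with h | rfl | h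
  · have e2 := qint_rec ((n : ℤ) + 1 - (m + 4))
    rw [show (n : ℤ) + 1 - (m + 4) + 1 = n + 1 - (m + 3) by ring,
      show (n : ℤ) + 1 - (m + 4) + 2 = n + 1 - (m + 2) by ring] at e2
    rw [if_neg (show ¬ m + 3 ≤ i by omega), if_neg (show ¬ m + 4 ≤ i by omega),
      if_neg (show ¬ i = m + 3 by omega)]
    rcases Nat.lt_or_ge i (m + 2) with h' | h'
    · rw [if_neg (by omega)]
      linear_combination (-qsum ((i : ℤ) - 1) / qsum n) * e2
    · obtain rfl : i = m + 2 := by omega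
      rw [if_pos le_rfl]
      push_cast
      linear_combination (-qsum ((m : ℤ) + 2 - 1) / qsum n) * e2
  · have e2 := qsum_mul_qint_sub ((m : ℤ) + 2) ((n : ℤ) - m - 3)
    rw [if_pos le_rfl, if_pos (by omega), if_neg (by omega), if_pos rfl]
    push_cast
    simp only [show (m : ℤ) + 3 - 1 = m + 2 by ring, show (m : ℤ) + 2 - 1 = m + 1 by ring,
      show (n : ℤ) + 1 - (m + 3) = n - m - 2 by ring,
      show (n : ℤ) + 1 - (m + 4) = n - m - 3 by ring,
      show (n : ℤ) - m - 3 + 1 = n - m - 2 by ring,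
      show (m : ℤ) + 2 + (n - m - 3) + 1 = n by ring,
      show (m : ℤ) + 1 + 1 = m + 2 by ring, show (m : ℤ) + 1 + 2 = m + 3 by ring,
      show (m : ℤ) + 2 + 1 = m + 3 by ring] at *
    field_simp
    linear_combination (-qint ((n : ℤ) - m - 2)) * e1 - e2
  · rw [if_pos (by omega), if_pos (by omega), if_pos (by omega), if_neg (by omega)]
    simp only [show (m : ℤ) + 3 - 1 = m + 2 by ring, show (m : ℤ) + 2 - 1 = m + 1 by ring,
      show (m : ℤ) + 4 - 1 = m + 3 by ring,
      show (m : ℤ) + 1 + 1 = m + 2 by ring, show (m : ℤ) + 1 + 2 = m + 3 by ring] at *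
    linear_combination (-qint ((n : ℤ) + 1 - i) / qsum n) * e1

/-- The inhomogeneous term is the value of `solB` at a twin node, fed in by the coupling. The
identity `[2][n] - [n-1] = [n+1]` explains the extra denominator of `solC`. -/
theorem solC_system_one {n i : ℕ} (hn : 1 ≤ n) :
    -qint 2 * solC n i 1 + solC n i 2 + qint ((n : ℤ) + 1 - i) / qsum n = 0 := by
  have hW : qsum n ≠ 0 := qsum_ne_zero (by omega)
  have hq : qint ((n : ℤ) + 1) ≠ 0 := by exact_mod_cast qint_ne_zero (m := n + 1) (by omega)
  have e1 := qint_rec ((n : ℤ) - 1)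
  simp only [solC]
  push_cast
  simp only [show (n : ℤ) - 1 + 1 = n by ring, show (n : ℤ) + 1 - 1 = n by ring,
    show (n : ℤ) - 1 + 2 = n + 1 by ring, show (n : ℤ) + 1 - 2 = n - 1 by ring] at *
  field_simp
  linear_combination (-qint ((n : ℤ) + 1 - i)) * e1

theorem solC_system_add_two (n i m : ℕ) :
    -qint 2 * solC n i (m + 2) + solC n i (m + 1) + solC n i (m + 3) = 0 := by
  have e1 := qint_rec ((n : ℤ) + 1 - (m + 3))
  simp only [solC]
  push_cast
  rw [show (n : ℤ) + 1 - (m + 3) + 1 = n + 1 - (m + 2) by ring,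
    show (n : ℤ) + 1 - (m + 3) + 2 = n + 1 - (m + 1) by ring] at e1
  linear_combination (-qint ((n : ℤ) + 1 - i) / (qint ((n : ℤ) + 1) * qsum n)) * e1

theorem sum_cartD_solB {n i k : ℕ} (h1 : 1 ≤ i) (hi : i ≤ n) (hk : k ≤ n) :
    ∑ j ∈ Finset.range (n + 1), cartD k j * solB n i j + (if max k 1 = i then 1 else 0) = 0 := by
  have hf := solB_last (h1.trans hi) hi
  have h01 := solB_system_le_one (h1.trans hi) h1 hi
  simp only [eq_comm (a := i)] at h01
  match k with
  | 0 =>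
    rw [sum_cartD_zero (h1.trans hi) hf, show solB n i 0 = solB n i 1 by simp [solB]]
    exact h01
  | 1 =>
    rw [sum_cartD_one (h1.trans hi) hf]
    exact h01
  | 2 =>
    have h := solB_system_two hk h1 hi
    simp only [eq_comm (a := i)] at h
    rw [sum_cartD_two hk hf]
    exact h
  | m + 3 =>
    have h := solB_system_add_three hk h1
    simp only [eq_comm (a := i)] at h
    rw [sum_cartD_add_three hk hf, show max (m + 3) 1 = m + 3 by omega]
    exact h

theorem sum_cartA_solC {n i k : ℕ} (hn : 1 ≤ n) (hk : k ≤ n) :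
    ∑ j ∈ Finset.Icc 1 n, cartA (max k 1) j * solC n i j +
      (if k ≤ 1 then solB n i (1 - k) else 0) = 0 := by
  have hf := solC_last n i
  match k with
  | 0 =>
    rw [show max 0 1 = 1 from rfl, sum_cartA_one hn hf, ← solC_system_one (i := i) hn]
    simp [solB]
  | 1 =>
    rw [show max 1 1 = 1 from rfl, sum_cartA_one hn hf, ← solC_system_one (i := i) hn]
    simp [solB]
  | m + 2 =>
    rw [show max (m + 2) 1 = m + 2 by omega, sum_cartA_add_two hk hf, if_neg (by omega), add_zero]
    exact solC_system_add_two n i m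

/-- A vector built from the solutions of the linear system is killed by every operator that acts
by the two `q`-Cartan matrices. -/
theorem apply_solution_eq_zero {N : Type*} [AddCommGroup N] [Module K N] {n i k : ℕ}
    (h1 : 1 ≤ i) (hi : i ≤ n) (hk : k ≤ n) (T : N →ₗ[K] N) (V : N) (B C : ℕ → N)
    (hV : T V = if max k 1 = i then B k else 0)
    (hB : ∀ j ≤ n, T (B j) = cartD k j • B k + if k + j = 1 then C 1 else 0)
    (hC : ∀ j, 1 ≤ j → j ≤ n → T (C j) = cartA (max k 1) j • C (max k 1)) :
    T (V + ∑ j ∈ Finset.range (n + 1), solB n i j • B j +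
      ∑ j ∈ Finset.Icc 1 n, solC n i j • C j) = 0 := by
  have hBs : ∑ j ∈ Finset.range (n + 1), T (solB n i j • B j) =
      (∑ j ∈ Finset.range (n + 1), cartD k j * solB n i j) • B k +
        (if k ≤ 1 then solB n i (1 - k) else 0) • C (max k 1) := by
    rw [Finset.sum_smul]
    have : (if k ≤ 1 then solB n i (1 - k) else 0) • C (max k 1) =
        ∑ j ∈ Finset.range (n + 1), if k + j = 1 then solB n i j • C 1 else 0 := by
      split_ifs with hk1
      -- The coupling joins only the two twin nodes, so at most one summand survives.
      · have : ∀ j, (k + j = 1) = (j = 1 - k) := fun j => propext (by omega)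
        simp only [this, Finset.sum_ite_eq', Finset.mem_range]
        rw [if_pos (by omega), show max k 1 = 1 by omega]
      · rw [zero_smul, Finset.sum_eq_zero]
        intro j _
        rw [if_neg (by omega)]
    rw [this, ← Finset.sum_add_distrib]
    refine Finset.sum_congr rfl fun j hj => ?_
    rw [map_smul, hB j (by simpa [Nat.lt_succ_iff] using hj), smul_add, smul_smul, mul_comm,
      smul_ite, smul_zero]
  have hCs : ∑ j ∈ Finset.Icc 1 n, T (solC n i j • C j) =
      (∑ j ∈ Finset.Icc 1 n, cartA (max k 1) j * solC n i j) • C (max k 1) := by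
    rw [Finset.sum_smul]
    refine Finset.sum_congr rfl fun j hj => ?_
    rw [Finset.mem_Icc] at hj
    rw [map_smul, hC j hj.1 hj.2, smul_smul, mul_comm]
  have hVs : T V = (if max k 1 = i then (1 : K) else 0) • B k := by
    rw [hV]; split_ifs <;> simp
  rw [map_add, map_add, map_sum, map_sum, hBs, hCs, hVs]
  -- The coefficients of `B k` and `C (max k 1)` in the image are the left-hand sides of row `k` of
  -- the two systems.
  have e1 := sum_cartD_solB h1 hi hk
  have e2 := sum_cartA_solC (i := i) (h1.trans hi) hk
  have e3 := congrArg (· • B k) e1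
  have e4 := congrArg (· • C (max k 1)) e2
  simp only [add_smul, zero_smul] at e3 e4
  rw [← add_zero (0 : N)]
  nth_rewrite 1 [← e3]
  rw [← e4]
  abel

/-! ### The universal property, the augmentation and the anti-involution -/

/-- The homomorphism from the Temperley--Lieb algebra of type `D` given by the images of the
generators. -/
def lift {n : ℕ} {A : Type*} [Ring A] [Algebra K A] (f : Fin (n + 1) → A)
    (hsq : ∀ i, f i * f i = (-qint 2) • f i)
    (hbraid : ∀ i j : Fin (n + 1), DynkinAdj i j → f i * f j * f i = f i)
    (hcomm : ∀ i j : Fin (n + 1), ¬ DynkinAdj i j → f i * f j = f j * f i) : TLD n →ₐ[K] A :=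
  RingQuot.liftAlgHom K ⟨FreeAlgebra.lift K f, by
    intro x y hxy
    cases hxy with
    | sq i => simpa only [map_mul, map_smul, FreeAlgebra.lift_ι_apply] using hsq i
    | braid i j h => simpa only [map_mul, FreeAlgebra.lift_ι_apply] using hbraid i j h
    | comm i j h => simpa only [map_mul, FreeAlgebra.lift_ι_apply] using hcomm i j h⟩

theorem lift_E {n : ℕ} {A : Type*} [Ring A] [Algebra K A] (f : Fin (n + 1) → A)
    (hsq : ∀ i, f i * f i = (-qint 2) • f i)
    (hbraid : ∀ i j : Fin (n + 1), DynkinAdj i j → f i * f j * f i = f i)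
    (hcomm : ∀ i j : Fin (n + 1), ¬ DynkinAdj i j → f i * f j = f j * f i) (i : Fin (n + 1)) :
    lift f hsq hbraid hcomm (E n i) = f i := by
  rw [lift, E, RingQuot.liftAlgHom_mkAlgHom_apply, FreeAlgebra.lift_ι_apply]

theorem incl_E {m n : ℕ} (h : m ≤ n) (i : Fin (m + 1)) :
    incl h (E m i) = E n (Fin.castLE (Nat.succ_le_succ h) i) := by
  rw [incl, E, RingQuot.liftAlgHom_mkAlgHom_apply, FreeAlgebra.lift_ι_apply]

@[elab_as_elim]
theorem induction_on {n : ℕ} {P : TLD n → Prop} (x : TLD n) (one : P 1)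
    (mul : ∀ i y, P y → P (E n i * y)) (add : ∀ y z, P y → P z → P (y + z))
    (smul : ∀ (c : K) y, P y → P (c • y)) : P x := by
  suffices h : ∀ a : FreeAlgebra K (Fin (n + 1)), ∀ y, P y → P (RingQuot.mkAlgHom K (Rel n) a * y) by
    obtain ⟨a, rfl⟩ := RingQuot.mkAlgHom_surjective K (Rel n) x
    simpa using h a 1 one
  intro a
  induction a using FreeAlgebra.induction with
  | grade0 r =>
    intro y hy
    rw [AlgHom.commutes, ← Algebra.smul_def]
    exact smul r y hy
  | grade1 i => exact fun y hy => mul i y hy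
  | mul a b ha hb =>
    intro y hy
    rw [map_mul, mul_assoc]
    exact ha _ (hb _ hy)
  | add a b ha hb =>
    intro y hy
    rw [map_add, add_mul]
    exact add _ _ (ha y hy) (hb y hy)

theorem algHom_ext {n : ℕ} {A : Type*} [Ring A] [Algebra K A] {f g : TLD n →ₐ[K] A}
    (h : ∀ i, f (E n i) = g (E n i)) : f = g := by
  refine AlgHom.ext fun x => ?_
  induction x using induction_on with
  | one => simp
  | mul i y hy => rw [map_mul, map_mul, h, hy]
  | add y z hy hz => rw [map_add, map_add, hy, hz]
  | smul c y hy => rw [map_smul, map_smul, hy]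

/-- The augmentation, which kills all generators. -/
def aug (n : ℕ) : TLD n →ₐ[K] K := lift (fun _ => 0) (by simp) (by simp) (by simp)

theorem aug_E (n : ℕ) (i : Fin (n + 1)) : aug n (E n i) = 0 := lift_E ..

theorem aug_incl {m n : ℕ} (h : m ≤ n) (x : TLD m) : aug n (incl h x) = aug m x := by
  have : (aug n).comp (incl h) = aug m := algHom_ext fun i => by
    rw [AlgHom.comp_apply, incl_E, aug_E, aug_E]
  rw [← this, AlgHom.comp_apply]

/-- The anti-involution that fixes the generators, as a homomorphism to the opposite algebra. -/
def anti (n : ℕ) : TLD n →ₐ[K] (TLD n)ᵐᵒᵖ :=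
  lift (fun i => MulOpposite.op (E n i))
    (fun i => by rw [← MulOpposite.op_mul, E_sq, MulOpposite.op_smul])
    (fun i j h => by rw [← MulOpposite.op_mul, ← MulOpposite.op_mul, ← mul_assoc, E_braid n i j h])
    (fun i j h => by rw [← MulOpposite.op_mul, ← MulOpposite.op_mul, E_comm n i j h])

theorem anti_E (n : ℕ) (i : Fin (n + 1)) : anti n (E n i) = MulOpposite.op (E n i) := lift_E ..

theorem aug_unop_anti (n : ℕ) (x : TLD n) : aug n (anti n x).unop = aug n x := by
  induction x using induction_on with
  | one => simp
  | mul i y hy => simp [map_mul, anti_E, aug_E]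
  | add y z hy hz => simp [hy, hz]
  | smul c y hy => simp [hy]

/-! ### Elements annihilated by the generators, and uniqueness -/

theorem mul_eq_aug_smul {n : ℕ} {Q : TLD n} (hQ : ∀ i, E n i * Q = 0) (x : TLD n) :
    x * Q = aug n x • Q := by
  induction x using induction_on with
  | one => simp
  | mul i y hy => rw [mul_assoc, hy, mul_smul_comm, hQ, map_mul, aug_E, zero_mul, zero_smul, smul_zero]
  | add y z hy hz => rw [add_mul, hy, hz, map_add, add_smul]
  | smul c y hy => rw [smul_mul_assoc, hy, map_smul, smul_assoc]

theorem mul_eq_aug_smul_left {n : ℕ} {Q : TLD n} (hQ : ∀ i, Q * E n i = 0) (x : TLD n) :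
    Q * x = aug n x • Q := by
  induction x using induction_on with
  | one => simp
  | mul i y hy => rw [← mul_assoc, hQ, zero_mul, map_mul, aug_E, zero_mul, zero_smul]
  | add y z hy hz => rw [mul_add, hy, hz, map_add, add_smul]
  | smul c y hy => rw [mul_smul_comm, hy, map_smul, smul_assoc]

/-- The image `Q*` of `Q` under the anti-involution is killed on the right. Evaluating `Q* Q` with
either factor as the annihilated one gives `Q* = Q`. -/
theorem mul_E_eq_zero_of_E_mul_eq_zero {n : ℕ} {Q : TLD n} (hQ : ∀ i, E n i * Q = 0)
    (h1 : aug n Q = 1) (i : Fin (n + 1)) : Q * E n i = 0 := by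
  have h2 : ∀ i, (anti n Q).unop * E n i = 0 := fun i => by
    have h := congrArg (fun x => (anti n x).unop) (hQ i)
    simpa [anti_E] using h
  have h3 : (anti n Q).unop = Q := by
    have h4 := mul_eq_aug_smul hQ (anti n Q).unop
    rwa [mul_eq_aug_smul_left h2, aug_unop_anti, h1, one_smul, one_smul] at h4
  rw [← h3, h2]

theorem IsJonesWenzl.aug_eq_one {Q : ∀ n : ℕ, TLD n} (hQ : IsJonesWenzl Q) (n : ℕ) :
    aug n (Q n) = 1 := by
  have h := hQ.mul_incl n n le_rfl
  rw [mul_eq_aug_smul_left (hQ.mul_E n), aug_incl] at h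
  have h2 : (aug n (Q n) - 1) • Q n = 0 := by
    refine (sub_smul (aug n (Q n)) 1 (Q n)).trans ?_
    rw [h, one_smul, sub_self]
  exact sub_eq_zero.1 ((smul_eq_zero.1 h2).resolve_right (hQ.ne_zero n))

theorem IsJonesWenzl.unique {Q Q' : ∀ n : ℕ, TLD n} (hQ : IsJonesWenzl Q) (hQ' : IsJonesWenzl Q') :
    Q = Q' := by
  funext n
  have h := mul_eq_aug_smul_left (hQ.mul_E n) (Q' n)
  rw [mul_eq_aug_smul (hQ'.E_mul n), hQ.aug_eq_one, hQ'.aug_eq_one, one_smul, one_smul] at h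
  exact h.symm

theorem isJonesWenzl_of_E_mul {Q : ∀ n : ℕ, TLD n} (hQ : ∀ n i, E n i * Q n = 0)
    (h1 : ∀ n, aug n (Q n) = 1) : IsJonesWenzl Q where
  ne_zero n h := by simpa [h] using h1 n
  mul_incl n m h := by
    rw [mul_eq_aug_smul_left (mul_E_eq_zero_of_E_mul_eq_zero (hQ n) (h1 n)), aug_incl, h1, one_smul]
  incl_mul n m h := by rw [mul_eq_aug_smul (hQ n), aug_incl, h1, one_smul]
  E_mul := hQ
  mul_E n := mul_E_eq_zero_of_E_mul_eq_zero (hQ n) (h1 n)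

/-! ### One-cup monomials -/

theorem DynkinAdj.symm {i j : ℕ} (h : DynkinAdj i j) : DynkinAdj j i := by
  unfold DynkinAdj at *; omega

/-- A family of elements satisfying the relations of the Temperley--Lieb algebra of type `D`,
indexed by `0, …, n`. -/
structure TLFamily {A : Type*} [Ring A] [Algebra K A] (n : ℕ) (e : ℕ → A) : Prop where
  sq : ∀ k ≤ n, e k * e k = (-qint 2) • e k
  braid : ∀ k ≤ n, ∀ j ≤ n, DynkinAdj k j → e k * e j * e k = e k
  comm : ∀ k ≤ n, ∀ j ≤ n, ¬ DynkinAdj k j → e k * e j = e j * e k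

section

variable {A : Type*} [Ring A]

/-- The product `e_j e_{j+1} ⋯ e_{j+m-1}`. -/
def asc (e : ℕ → A) : ℕ → ℕ → A
  | _, 0 => 1
  | j, m + 1 => e j * asc e (j + 1) m

/-- The product `e_{a+m} ⋯ e_{a+1} e_a`. -/
def desc (e : ℕ → A) (a : ℕ) : ℕ → A
  | 0 => e a
  | m + 1 => e (a + m + 1) * desc e a m

/-- The product of the `e_k` along the path from `j` to `a ≥ 1` in the Dynkin diagram. -/
def cupB (e : ℕ → A) (a j : ℕ) : A :=
  if j = 0 then e 0 * (if a = 1 then e 2 * e 1 else asc e 2 (a - 1))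
  else if j ≤ a then asc e j (a + 1 - j) else desc e a (j - a)

/-- The product `e_j e_{j-1} ⋯ e_1 e_0 e_2 e_3 ⋯ e_a`, for `j ≥ 1`. -/
def cupC (e : ℕ → A) (a : ℕ) : ℕ → A
  | 0 => 1
  | 1 => e 1 * (e 0 * asc e 2 (a - 1))
  | m + 2 => e (m + 2) * cupC e a (m + 1)

theorem asc_one (e : ℕ → A) (j : ℕ) : asc e j 1 = e j := by simp [asc]

theorem cupB_self (e : ℕ → A) {a : ℕ} (ha : 1 ≤ a) : cupB e a a = e a := by
  rw [cupB, if_neg (by omega), if_pos le_rfl, show a + 1 - a = 1 by omega, asc_one]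

theorem cupB_eq_mul_succ (e : ℕ → A) {a j : ℕ} (hj : 1 ≤ j) (hja : j < a) :
    cupB e a j = e j * cupB e a (j + 1) := by
  rw [cupB, cupB, if_neg (show ¬ j = 0 by omega), if_neg (show ¬ j + 1 = 0 by omega),
    if_pos (show j ≤ a by omega), if_pos (show j + 1 ≤ a by omega), show a + 1 - j = (a + 1 - (j + 1)) + 1 by omega, asc]

theorem cupB_succ (e : ℕ → A) {a j : ℕ} (ha : 1 ≤ a) (hja : a ≤ j) :
    cupB e a (j + 1) = e (j + 1) * cupB e a j := by
  rw [cupB, if_neg (by omega), if_neg (by omega), show j + 1 - a = (j - a) + 1 by omega, desc,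
    show a + (j - a) + 1 = j + 1 by omega]
  rcases Nat.eq_or_lt_of_le hja with rfl | h
  · rw [cupB_self e ha, Nat.sub_self, desc]
  · rw [cupB, if_neg (by omega), if_neg (by omega)]

theorem cupB_zero (e : ℕ → A) {a : ℕ} (ha : 1 ≤ a) : cupB e a 0 = e 0 * cupB e a 2 := by
  rw [cupB, if_pos rfl]
  split_ifs with h
  · subst h
    rw [cupB_succ e ha le_rfl, cupB_self e ha]
  · rw [cupB, if_neg (by omega), if_pos (by omega), show a + 1 - 2 = a - 1 by omega]

theorem cupB_eq_mul (e : ℕ → A) {a : ℕ} (ha : 1 ≤ a) (j : ℕ) : ∃ X, cupB e a j = e j * X := by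
  rcases Nat.eq_zero_or_pos j with rfl | hj
  · exact ⟨_, cupB_zero e ha⟩
  rcases Nat.lt_trichotomy j a with h | rfl | h
  · exact ⟨_, cupB_eq_mul_succ e hj h⟩
  · exact ⟨1, by rw [cupB_self e ha, mul_one]⟩
  · obtain ⟨m, rfl⟩ : ∃ m, j = m + 1 := ⟨j - 1, by omega⟩
    exact ⟨_, cupB_succ e ha (by omega)⟩

theorem cupC_succ (e : ℕ → A) (a : ℕ) {j : ℕ} (hj : 1 ≤ j) :
    cupC e a (j + 1) = e (j + 1) * cupC e a j := by
  obtain ⟨m, rfl⟩ : ∃ m, j = m + 1 := ⟨j - 1, by omega⟩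
  rfl

theorem cupC_eq_mul (e : ℕ → A) (a : ℕ) {j : ℕ} (hj : 1 ≤ j) : ∃ X, cupC e a j = e j * X := by
  rcases Nat.eq_or_lt_of_le hj with rfl | h
  · exact ⟨_, rfl⟩
  · obtain ⟨m, rfl⟩ : ∃ m, j = m + 1 := ⟨j - 1, by omega⟩
    exact ⟨_, cupC_succ e a (by omega)⟩

namespace TLFamily

variable [Algebra K A] {n a : ℕ} {e : ℕ → A}

theorem mul_cupB_self (h : TLFamily n e) (ha : 1 ≤ a) {j : ℕ} (hj : j ≤ n) :
    e j * cupB e a j = (-qint 2) • cupB e a j := by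
  obtain ⟨X, hX⟩ := cupB_eq_mul e ha j
  rw [hX, ← mul_assoc, h.sq j hj, smul_mul_assoc]

theorem mul_mul_cupB (h : TLFamily n e) (ha : 1 ≤ a) {j k : ℕ} (hj : j ≤ n) (hk : k ≤ n)
    (hkj : DynkinAdj k j) : e k * (e j * cupB e a k) = cupB e a k := by
  obtain ⟨X, hX⟩ := cupB_eq_mul e ha k
  rw [hX, ← mul_assoc, ← mul_assoc, h.braid k hk j hj hkj]

theorem mul_mul_cupC (h : TLFamily n e) {j k : ℕ} (hj : j ≤ n) (hk : k ≤ n) (h1 : 1 ≤ k)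
    (hkj : DynkinAdj k j) : e k * (e j * cupC e a k) = cupC e a k := by
  obtain ⟨X, hX⟩ := cupC_eq_mul e a h1
  rw [hX, ← mul_assoc, ← mul_assoc, h.braid k hk j hj hkj]

/-- The diagram is a tree: a step to a neighbour either lengthens the path to `a` or backtracks
along it, and a backtrack is absorbed by `e_k e_j e_k = e_k`. -/
theorem mul_cupB_of_adj (h : TLFamily n e) (ha : 1 ≤ a) {j k : ℕ} (hj : j ≤ n) (hk : k ≤ n)
    (hkj : DynkinAdj k j) : e k * cupB e a j = cupB e a k := by
  have key := hkj
  rcases hkj with ⟨h1, rfl⟩ | ⟨h1, rfl⟩ | ⟨rfl, rfl⟩ | ⟨rfl, rfl⟩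
  · rcases Nat.lt_or_ge k a with h2 | h2
    · rw [cupB_eq_mul_succ e h1 h2]
    · rw [cupB_succ e ha h2, h.mul_mul_cupB ha hj hk key]
  · rcases Nat.lt_or_ge j a with h2 | h2
    · rw [cupB_eq_mul_succ e h1 h2, h.mul_mul_cupB ha hj hk key]
    · rw [cupB_succ e ha h2]
  · rw [cupB_zero e ha]
  · rw [cupB_zero e ha, h.mul_mul_cupB ha hj hk key]

/-- For `a = 1` and `j = 0` the path is `0, 2, 1`, and `e_1 e_0 e_2 e_1 = e_0 e_1 e_2 e_1 = e_0
e_1`. This uses the relations of node `2`, hence `hn`. -/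
theorem mul_cupB_of_add_eq_one (h : TLFamily n e) (ha : 1 ≤ a) (han : a ≤ n) {j k : ℕ}
    (hkj : k + j = 1) (hn : j = 0 → 2 ≤ n) : e k * cupB e a j = cupC e a 1 := by
  have h01 : e 0 * e 1 = e 1 * e 0 :=
    h.comm 0 (by omega) 1 (by omega) (by unfold DynkinAdj; omega)
  rcases Nat.eq_zero_or_pos k with rfl | hk
  · obtain rfl : j = 1 := by omega
    rw [cupB, if_neg (by omega), if_pos ha, show a + 1 - 1 = (a - 1) + 1 by omega, asc, cupC,
      ← mul_assoc, ← mul_assoc, h01]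
  · obtain rfl : k = 1 := by omega
    obtain rfl : j = 0 := by omega
    rw [cupB, if_pos rfl, cupC]
    split_ifs with h1
    · subst h1
      rw [← mul_assoc, ← h01, mul_assoc, ← mul_assoc (e 1),
        h.braid 1 han 2 (hn rfl) (by unfold DynkinAdj; omega), asc, mul_one, h01]
    · rfl

theorem mul_cupC_self (h : TLFamily n e) {j k : ℕ} (hj : j ≤ n) (h1 : 1 ≤ j)
    (hkj : max k 1 = j) : e k * cupC e a j = (-qint 2) • cupC e a j := by
  rcases Nat.eq_zero_or_pos k with rfl | hk
  · obtain rfl : j = 1 := by omega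
    have h01 : e 0 * e 1 = e 1 * e 0 :=
      h.comm 0 (by omega) 1 (by omega) (by unfold DynkinAdj; omega)
    rw [cupC, ← mul_assoc, h01, mul_assoc, ← mul_assoc (e 0), h.sq 0 (by omega), smul_mul_assoc,
      mul_smul_comm]
  · obtain rfl : j = k := by omega
    obtain ⟨X, hX⟩ := cupC_eq_mul e a h1
    rw [hX, ← mul_assoc, h.sq j hj, smul_mul_assoc]

/-- Once both `e_0` and `e_1` occur at the left end, they act alike: `e_0 e_2 e_1 e_0 = e_0 e_2 e_0
e_1 = e_0 e_1`. This is why `c_j` sees a type `A` diagram, with `max k 1` merging the twin nodes. -/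
theorem mul_cupC_of_adj (h : TLFamily n e) {j k : ℕ} (hj : j ≤ n) (h1 : 1 ≤ j) (hk : k ≤ n)
    (hkj : j = max k 1 + 1 ∨ max k 1 = j + 1) : e k * cupC e a j = cupC e a (max k 1) := by
  rcases Nat.eq_zero_or_pos k with rfl | hk0
  · obtain rfl : j = 2 := by omega
    have h01 : e 1 * e 0 = e 0 * e 1 :=
      h.comm 1 (by omega) 0 (by omega) (by unfold DynkinAdj; omega)
    rw [show max 0 1 = 1 from rfl, cupC_succ e a le_rfl, cupC, ← mul_assoc, ← mul_assoc (e 1), h01,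
      mul_assoc (e 0) (e 1), ← mul_assoc (e 0 * e (1 + 1)),
      h.braid 0 hk (1 + 1) hj (by unfold DynkinAdj; omega)]
  · rw [show max k 1 = k by omega] at *
    rcases hkj with rfl | rfl
    · rw [cupC_succ e a hk0, h.mul_mul_cupC hj hk hk0 (by unfold DynkinAdj; omega)]
    · rw [cupC_succ e a h1]

end TLFamily

end

/-! ### Existence of the Jones--Wenzl projections -/

namespace TLFamily

variable {A : Type*} [Ring A] [Algebra K A] {n : ℕ} {e : ℕ → A} {Q : A}

theorem mul_asc_comm (h : TLFamily n e) {k : ℕ} (hk : k ≤ n) (m j : ℕ) (hm : j + m ≤ n + 1)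
    (hkj : ∀ l, j ≤ l → ¬ DynkinAdj k l) : e k * asc e j m = asc e j m * e k := by
  induction m generalizing j with
  | zero => simp [asc]
  | succ m ih =>
    rw [asc, ← mul_assoc, h.comm k hk j (by omega) (hkj j le_rfl), mul_assoc,
      ih (j + 1) (by omega) (fun l hl => hkj l (by omega)), mul_assoc]

theorem mul_cupB_comm (h : TLFamily n e) {k j : ℕ} (hj : j ≤ n) (h2 : k + 2 ≤ j)
    (h3 : k = 0 → 3 ≤ j) : e k * cupB e n j = cupB e n j * e k := by
  rw [cupB, if_neg (by omega), if_pos hj]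
  exact h.mul_asc_comm (by omega) _ _ (by omega) fun l hl => by unfold DynkinAdj; omega

theorem mul_cupB_mul_eq_zero_of_lt (h : TLFamily n e) (hQ : ∀ k < n, e k * Q = 0) {k j : ℕ}
    (hj : j ≤ n) (h2 : k + 2 ≤ j) (h3 : k = 0 → 3 ≤ j) : e k * (cupB e n j * Q) = 0 := by
  rw [← mul_assoc, h.mul_cupB_comm hj h2 h3, mul_assoc, hQ k (by omega), mul_zero]

/-- Moving `e_k` to the right past distant factors leads to `e_{k-2} b_k Q`, where `e_{k-2}`
commutes through to `Q` and kills it. -/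
theorem mul_cupB_mul_eq_zero_of_gt (h : TLFamily n e) (hQ : ∀ k < n, e k * Q = 0) (d : ℕ) {j : ℕ}
    (hj : 1 ≤ j) (hd : j + 2 + d ≤ n) : e (j + 2 + d) * (cupB e n j * Q) = 0 := by
  have hcomm := h.comm (j + 2 + d) hd j (by omega) (by unfold DynkinAdj; omega)
  rw [cupB_eq_mul_succ e hj (by omega), mul_assoc, ← mul_assoc, hcomm, mul_assoc]
  induction d generalizing j with
  | zero =>
    rw [← mul_assoc (e (j + 2 + 0)), h.mul_cupB_of_adj (by omega) (by omega) hd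
      (by unfold DynkinAdj; omega), h.mul_cupB_mul_eq_zero_of_lt hQ (by omega) (by omega) (by omega)]
  | succ d ih =>
    have hcomm' := h.comm (j + 1 + 2 + d) (by omega) (j + 1) (by omega) (by unfold DynkinAdj; omega)
    rw [show j + 2 + (d + 1) = j + 1 + 2 + d by ring, cupB_eq_mul_succ e (j := j + 1) (by omega)
      (by omega), mul_assoc, ← mul_assoc (e (j + 1 + 2 + d)), hcomm', mul_assoc,
      ih (by omega) (by omega) hcomm', mul_zero]

theorem mul_cupB_mul_eq_zero (h : TLFamily n e) (hn : 2 ≤ n) (hQ : ∀ k < n, e k * Q = 0) {k j : ℕ}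
    (hk : k ≤ n) (hj : j ≤ n) (hne : j ≠ k) (hkj : ¬ DynkinAdj k j) (h1 : k + j ≠ 1) :
    e k * (cupB e n j * Q) = 0 := by
  unfold DynkinAdj at hkj
  rcases Nat.lt_or_ge k j with hlt | hge
  · exact h.mul_cupB_mul_eq_zero_of_lt hQ hj (by omega) (by omega)
  rcases Nat.eq_zero_or_pos j with rfl | hj0
  · have hcomm := h.comm k hk 0 (by omega) (by unfold DynkinAdj; omega)
    rw [cupB_zero e (by omega), mul_assoc, ← mul_assoc, hcomm, mul_assoc]
    obtain ⟨d, rfl⟩ : ∃ d, k = d + 3 := ⟨k - 3, by omega⟩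
    rcases Nat.eq_zero_or_pos d with rfl | hd
    · rw [← mul_assoc (e (0 + 3)), h.mul_cupB_of_adj (by omega) (by omega) hk
        (by unfold DynkinAdj; omega), h.mul_cupB_mul_eq_zero_of_lt hQ hk (by omega) (by omega)]
    · rw [show d + 3 = 2 + 2 + (d - 1) by omega,
        h.mul_cupB_mul_eq_zero_of_gt hQ _ (by omega) (by omega), mul_zero]
  · rw [show k = j + 2 + (k - j - 2) by omega,
      h.mul_cupB_mul_eq_zero_of_gt hQ _ (by omega) (by omega)]

theorem mul_cupC_mul_eq_zero_of_gt (h : TLFamily n e) (hQ : ∀ k < n, e k * Q = 0) {j k : ℕ}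
    (hj : 1 ≤ j) (hk : k ≤ n) (hkj : j + 2 ≤ k) : e k * (cupC e n j * Q) = 0 := by
  induction j, hj using Nat.le_induction with
  | base =>
    have h1 := h.comm k hk 1 (by omega) (by unfold DynkinAdj; omega)
    have h2 : cupC e n 1 = e 1 * cupB e n 0 := by
      rw [cupC, cupB, if_pos rfl, if_neg (by omega)]
    rw [h2, mul_assoc, ← mul_assoc, h1, mul_assoc, h.mul_cupB_mul_eq_zero (by omega) hQ hk
      (by omega) (by omega) (by unfold DynkinAdj; omega) (by omega), mul_zero]
  | succ j hj ih =>
    have h1 := h.comm k hk (j + 1) (by omega) (by unfold DynkinAdj; omega)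
    rw [cupC_succ e n hj, mul_assoc, ← mul_assoc, h1, mul_assoc, ih (by omega), mul_zero]

/-- With `m = max k 1`, moving `e_k` to the right past the larger leading factors leads to `e_{m+2}
c_m Q`, which is zero by the previous lemma. -/
theorem mul_cupC_mul_eq_zero_of_lt (h : TLFamily n e) (hQ : ∀ k < n, e k * Q = 0) {j k : ℕ}
    (hj : j ≤ n) (hkj : max k 1 + 2 ≤ j) : e k * (cupC e n j * Q) = 0 := by
  induction j, hkj using Nat.le_induction with
  | base =>
    have h1 := h.comm k (by omega) (max k 1 + 2) hj (by unfold DynkinAdj; omega)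
    rw [cupC_succ e n (by omega), mul_assoc, ← mul_assoc, h1, mul_assoc, ← mul_assoc (e k),
      h.mul_cupC_of_adj (by omega) (by omega) (by omega) (by omega),
      h.mul_cupC_mul_eq_zero_of_gt hQ (by omega) hj le_rfl]
  | succ j hkj ih =>
    have h1 := h.comm k (by omega) (j + 1) (by omega) (by unfold DynkinAdj; omega)
    rw [cupC_succ e n (by omega), mul_assoc, ← mul_assoc, h1, mul_assoc, ih (by omega), mul_zero]

/-- If `Q` is killed by the generators below `n`, a combination of the products of one-cup monomials
with `Q` is killed by all generators up to `n`. -/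
theorem mul_nextProjection_eq_zero (h : TLFamily n e) (hn : 2 ≤ n) (hQ : ∀ k < n, e k * Q = 0) {k : ℕ}
    (hk : k ≤ n) : e k * (Q + ∑ j ∈ Finset.range (n + 1), solB n n j • (cupB e n j * Q) +
      ∑ j ∈ Finset.Icc 1 n, solC n n j • (cupC e n j * Q)) = 0 := by
  refine apply_solution_eq_zero (by omega) le_rfl hk (LinearMap.mulLeft K (e k)) Q
    (fun j => cupB e n j * Q) (fun j => cupC e n j * Q) ?_ ?_ ?_
  · rw [LinearMap.mulLeft_apply]
    split_ifs with h1
    · obtain rfl : k = n := by omega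
      rw [cupB_self e (by omega)]
    · exact hQ k (by omega)
  · intro j hj
    rw [LinearMap.mulLeft_apply]
    by_cases h1 : k + j = 1
    · rw [if_pos h1, cartD, if_neg (by omega), if_neg (by unfold DynkinAdj; omega), zero_smul,
        zero_add, ← mul_assoc, h.mul_cupB_of_add_eq_one (by omega) le_rfl h1 (by omega)]
    rw [if_neg h1, add_zero, cartD]
    split_ifs with h2 h3
    · subst h2
      rw [← mul_assoc, h.mul_cupB_self (by omega) hj, smul_mul_assoc]
    · rw [← mul_assoc, h.mul_cupB_of_adj (by omega) hj hk h3, one_smul]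
    · rw [h.mul_cupB_mul_eq_zero hn hQ hk hj h2 h3 h1, zero_smul]
  · intro j hj1 hj
    rw [LinearMap.mulLeft_apply, cartA]
    split_ifs with h2 h3
    · rw [← h2, ← mul_assoc, h.mul_cupC_self hj hj1 h2.symm, smul_mul_assoc]
    · rw [← mul_assoc, h.mul_cupC_of_adj hj hj1 hk h3, one_smul]
    · rw [zero_smul]
      rcases Nat.lt_or_ge j (max k 1) with h4 | h4
      · exact h.mul_cupC_mul_eq_zero_of_gt hQ hj1 hk (by omega)
      · exact h.mul_cupC_mul_eq_zero_of_lt hQ hj (by omega)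

end TLFamily

/-- The generators indexed by all natural numbers, extended by zero. -/
def gen (n k : ℕ) : TLD n := if h : k ≤ n then E n ⟨k, Nat.lt_succ_of_le h⟩ else 0

theorem gen_val (n : ℕ) (i : Fin (n + 1)) : gen n i = E n i := by
  rw [gen, dif_pos (Nat.le_of_lt_succ i.2)]

theorem tlFamily_gen (n : ℕ) : TLFamily n (gen n) where
  sq k hk := by rw [gen, dif_pos hk]; exact E_sq n _
  braid k hk j hj h := by rw [gen, gen, dif_pos hk, dif_pos hj]; exact E_braid n _ _ h
  comm k hk j hj h := by rw [gen, gen, dif_pos hk, dif_pos hj]; exact E_comm n _ _ h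

theorem incl_gen {m n : ℕ} (h : m ≤ n) {k : ℕ} (hk : k ≤ m) : incl h (gen m k) = gen n k := by
  rw [gen, gen, dif_pos hk, dif_pos (hk.trans h), incl_E]
  rfl

theorem aug_gen (n k : ℕ) : aug n (gen n k) = 0 := by
  rw [gen]
  split_ifs
  · exact aug_E ..
  · exact map_zero _

theorem aug_cupB {n a : ℕ} (ha : 1 ≤ a) (j : ℕ) : aug n (cupB (gen n) a j) = 0 := by
  obtain ⟨X, hX⟩ := cupB_eq_mul (gen n) ha j
  rw [hX, map_mul, aug_gen, zero_mul]

theorem aug_cupC {n a j : ℕ} (hj : 1 ≤ j) : aug n (cupC (gen n) a j) = 0 := by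
  obtain ⟨X, hX⟩ := cupC_eq_mul (gen n) a hj
  rw [hX, map_mul, aug_gen, zero_mul]

theorem exists_gen_mul_eq_zero (n : ℕ) :
    ∃ Q : TLD n, (∀ k ≤ n, gen n k * Q = 0) ∧ aug n Q = 1 := by
  have hsq : ∀ {n k : ℕ}, k ≤ n → gen n k * (1 + (qint 2)⁻¹ • gen n k) = 0 := by
    intro n k hk
    rw [mul_add, mul_one, mul_smul_comm, (tlFamily_gen n).sq k hk, smul_smul, mul_neg,
      inv_mul_cancel₀ qint_two_ne_zero, neg_smul, one_smul, add_neg_cancel]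
  induction n with
  | zero =>
    refine ⟨1 + (qint 2)⁻¹ • gen 0 0, fun k hk => ?_, by simp [aug_gen]⟩
    obtain rfl : k = 0 := by omega
    exact hsq le_rfl
  | succ n ih =>
    obtain ⟨Q, hQ, h1⟩ := ih
    have hQ' : ∀ k < n + 1, gen (n + 1) k * incl n.le_succ Q = 0 := fun k hk => by
      rw [← incl_gen n.le_succ (Nat.le_of_lt_succ hk), ← map_mul, hQ k (Nat.le_of_lt_succ hk),
        map_zero]
    -- Rank two is separate: nodes `0` and `1` commute and there is no node `2`, so the projection
    -- is a product of two commuting factors.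
    rcases Nat.eq_zero_or_pos n with rfl | hn
    · refine ⟨(1 + (qint 2)⁻¹ • gen 1 1) * incl (Nat.le_succ 0) Q, fun k hk => ?_, ?_⟩
      · rcases Nat.eq_zero_or_pos k with rfl | hk0
        · have h01 := (tlFamily_gen 1).comm 0 hk 1 le_rfl (by unfold DynkinAdj; omega)
          have h2 : gen 1 0 * (1 + (qint 2)⁻¹ • gen 1 1) = (1 + (qint 2)⁻¹ • gen 1 1) * gen 1 0 := by
            rw [mul_add, add_mul, mul_one, one_mul, mul_smul_comm, smul_mul_assoc, h01]
          rw [← mul_assoc, h2, mul_assoc, hQ' 0 (by omega), mul_zero]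
        · obtain rfl : k = 1 := by omega
          rw [← mul_assoc, hsq le_rfl, zero_mul]
      · rw [map_mul, aug_incl, h1]
        simp [aug_gen]
    · refine ⟨_, fun k hk => (tlFamily_gen (n + 1)).mul_nextProjection_eq_zero (by omega) hQ' hk, ?_⟩
      have hB : ∀ j, aug (n + 1) (cupB (gen (n + 1)) (n + 1) j) = 0 := aug_cupB (by omega)
      rw [map_add, map_add, map_sum, map_sum, aug_incl, h1, Finset.sum_eq_zero, Finset.sum_eq_zero,
        add_zero, add_zero]
      · intro j hj
        rw [map_smul, map_mul, aug_cupC (Finset.mem_Icc.1 hj).1, zero_mul, smul_zero]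
      · intro j _
        rw [map_smul, map_mul, hB, zero_mul, smul_zero]

theorem exists_isJonesWenzl : ∃ Q : ∀ n : ℕ, TLD n, IsJonesWenzl Q := by
  choose Q hQ h1 using exists_gen_mul_eq_zero
  refine ⟨Q, isJonesWenzl_of_E_mul (fun n i => ?_) h1⟩
  rw [← gen_val]
  exact hQ n i (Nat.le_of_lt_succ i.2)

/-! ### A module detecting the coefficients -/

/-- The labels of the basis of the one-cup module: the identity, the cups without and the cups with
a decorated loop. -/
inductive CupState : Type
  | v : CupState
  | b : ℕ → CupState
  | c : ℕ → CupState

open CupState Finsupp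

/-- The action of the generator `k` on the basis of the one-cup module. -/
def cupAct (i k : ℕ) : CupState → (CupState →₀ K)
  | v => if max k 1 = i then single (b k) 1 else 0
  | b j => cartD k j • single (b k) 1 + if k + j = 1 then single (c 1) 1 else 0
  | c j => cartA (max k 1) j • single (c (max k 1)) 1

/-- The action of the generator `k` on the one-cup module. -/
def cupOp (i k : ℕ) : Module.End K (CupState →₀ K) := Finsupp.linearCombination K (cupAct i k)

theorem cupOp_single (i k : ℕ) (s : CupState) : cupOp i k (single s 1) = cupAct i k s := by
  rw [cupOp, Finsupp.linearCombination_single, one_smul]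

theorem cupOp_b_self (i k : ℕ) : cupOp i k (single (b k) 1) = (-qint 2) • single (b k) 1 := by
  rw [cupOp_single, cupAct, if_neg (by omega), cartD, if_pos rfl, add_zero]

theorem cupOp_c_self (i k : ℕ) :
    cupOp i k (single (c (max k 1)) 1) = (-qint 2) • single (c (max k 1)) 1 := by
  rw [cupOp_single, cupAct, cartA, if_pos rfl]

theorem cupOp_b_of_adj {i k j : ℕ} (h : DynkinAdj k j) :
    cupOp i k (single (b j) 1) = single (b k) 1 := by
  rw [cupOp_single, cupAct, if_neg, cartD, if_neg, if_pos h, one_smul, add_zero] <;>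
    · unfold DynkinAdj at h; omega

theorem cupOp_b_of_add_eq_one {i k j : ℕ} (h : k + j = 1) :
    cupOp i k (single (b j) 1) = single (c 1) 1 := by
  rw [cupOp_single, cupAct, if_pos h, cartD, if_neg (by omega),
    if_neg (by unfold DynkinAdj; omega), zero_smul, zero_add]

theorem cupOp_b_eq_zero {i k j : ℕ} (hne : j ≠ k) (h : ¬ DynkinAdj k j) (h1 : k + j ≠ 1) :
    cupOp i k (single (b j) 1) = 0 := by
  rw [cupOp_single, cupAct, if_neg h1, cartD, if_neg hne, if_neg h, zero_smul, zero_add]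

theorem cupOp_c_of_adj {i k j : ℕ} (h : j = max k 1 + 1 ∨ max k 1 = j + 1) :
    cupOp i k (single (c j) 1) = single (c (max k 1)) 1 := by
  rw [cupOp_single, cupAct, cartA, if_neg (by omega), if_pos h, one_smul]

theorem cupOp_c_eq_zero {i k j : ℕ} (hne : j ≠ max k 1)
    (h : ¬ (j = max k 1 + 1 ∨ max k 1 = j + 1)) : cupOp i k (single (c j) 1) = 0 := by
  rw [cupOp_single, cupAct, cartA, if_neg hne, if_neg h, zero_smul]

/-- The image of `cupOp i k` lies in the span of `b k` and `c (max k 1)`, so a relation ending in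
this operator needs checking on two vectors only. -/
theorem comp_cupOp_ext {i k : ℕ} {f g : Module.End K (CupState →₀ K)}
    (hb : f (single (b k) 1) = g (single (b k) 1))
    (hc : f (single (c (max k 1)) 1) = g (single (c (max k 1)) 1)) :
    f * cupOp i k = g * cupOp i k := by
  refine Finsupp.lhom_ext' fun s => LinearMap.ext_ring ?_
  simp only [LinearMap.comp_apply, Finsupp.lsingle_apply, Module.End.mul_apply, cupOp_single]
  cases s with
  | v => rw [cupAct]; split_ifs <;> simp [hb]
  | b j =>
    rw [cupAct]
    split_ifs with h
    · rw [show max k 1 = 1 by omega] at hc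
      simp only [map_add, map_smul, hb, hc]
    · simp only [map_add, map_smul, hb, map_zero]
  | c j => simp only [cupAct, map_smul, hc]

theorem cupOp_sq (i k : ℕ) : cupOp i k * cupOp i k = (-qint 2) • cupOp i k := by
  have := comp_cupOp_ext (i := i) (k := k) (f := cupOp i k) (g := (-qint 2) • 1)
    (by rw [cupOp_b_self]; rfl) (by rw [cupOp_c_self]; rfl)
  rw [this, smul_mul_assoc, one_mul]

theorem cupOp_braid {i k j : ℕ} (h : DynkinAdj k j) :
    cupOp i k * cupOp i j * cupOp i k = cupOp i k := by
  have := comp_cupOp_ext (i := i) (k := k) (f := cupOp i k * cupOp i j) (g := 1)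
    (by rw [Module.End.mul_apply, cupOp_b_of_adj h.symm, cupOp_b_of_adj h]; rfl)
    (by rw [Module.End.mul_apply, cupOp_c_of_adj (by unfold DynkinAdj at h; omega),
          cupOp_c_of_adj (by unfold DynkinAdj at h; omega)]; rfl)
  rw [this, one_mul]

theorem cupOp_mul_eq_zero {i k j : ℕ} (hne : j ≠ k) (h : ¬ DynkinAdj k j) (h1 : k + j ≠ 1) :
    cupOp i k * cupOp i j = 0 := by
  have := comp_cupOp_ext (i := i) (k := j) (f := cupOp i k) (g := 0)
    (by rw [cupOp_b_eq_zero hne h h1]; rfl)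
    (by rw [cupOp_c_eq_zero] <;> first | rfl | (unfold DynkinAdj at h; omega))
  rw [this, zero_mul]

theorem cupOp_zero_mul_one (i : ℕ) : cupOp i 0 * cupOp i 1 = cupOp i 1 * cupOp i 0 := by
  have hb0 : cupOp i 0 (single (b 0) 1) = (-qint 2) • single (b 0) 1 := cupOp_b_self i 0
  have hb1 : cupOp i 1 (single (b 1) 1) = (-qint 2) • single (b 1) 1 := cupOp_b_self i 1
  have hc0 : cupOp i 0 (single (c 1) 1) = (-qint 2) • single (c 1) 1 := cupOp_c_self i 0
  have hc1 : cupOp i 1 (single (c 1) 1) = (-qint 2) • single (c 1) 1 := cupOp_c_self i 1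
  have h01 : cupOp i 0 (single (b 1) 1) = single (c 1) 1 := cupOp_b_of_add_eq_one rfl
  have h10 : cupOp i 1 (single (b 0) 1) = single (c 1) 1 := cupOp_b_of_add_eq_one rfl
  refine Finsupp.lhom_ext' fun s => LinearMap.ext_ring ?_
  simp only [LinearMap.comp_apply, Finsupp.lsingle_apply, Module.End.mul_apply]
  cases s with
  | v =>
    simp only [cupOp_single i _ v, cupAct, show max 0 1 = max 1 1 from rfl]
    split_ifs
    · rw [h01, h10]
    · simp
  | b j =>
    by_cases hj0 : j = 0
    · subst hj0; rw [h10, hb0, hc0, map_smul, h10]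
    by_cases hj1 : j = 1
    · subst hj1; rw [h01, hb1, hc1, map_smul, h01]
    by_cases hj2 : j = 2
    · subst hj2
      rw [cupOp_b_of_adj (k := 0) (by unfold DynkinAdj; omega),
        cupOp_b_of_adj (k := 1) (by unfold DynkinAdj; omega), h01, h10]
    · rw [cupOp_b_eq_zero (k := 0), cupOp_b_eq_zero (k := 1), map_zero, map_zero] <;>
        first | omega | (unfold DynkinAdj; omega)
  | c j =>
    simp only [cupOp_single i _ (c j), cupAct, show max 0 1 = max 1 1 from rfl, map_smul]
    rw [show max 1 1 = 1 from rfl, hc0, hc1]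

theorem cupOp_comm {i k j : ℕ} (h : ¬ DynkinAdj k j) :
    cupOp i k * cupOp i j = cupOp i j * cupOp i k := by
  have h' : ¬ DynkinAdj j k := fun h2 => h h2.symm
  by_cases hne : j = k
  · rw [hne]
  by_cases h1 : k + j = 1
  · rcases Nat.eq_zero_or_pos k with rfl | hk
    · obtain rfl : j = 1 := by omega
      exact cupOp_zero_mul_one i
    · obtain rfl : k = 1 := by omega
      obtain rfl : j = 0 := by omega
      exact (cupOp_zero_mul_one i).symm
  · rw [cupOp_mul_eq_zero hne h h1, cupOp_mul_eq_zero (Ne.symm hne) h' (by omega)]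

/-- The one-cup module. -/
def cupRep (n i : ℕ) : TLD n →ₐ[K] Module.End K (CupState →₀ K) :=
  lift (fun k => cupOp i k) (fun k => cupOp_sq i k) (fun _ _ h => cupOp_braid h)
    (fun _ _ h => cupOp_comm h)

theorem cupRep_E (n i : ℕ) (k : Fin (n + 1)) : cupRep n i (E n k) = cupOp i k := lift_E ..

theorem cupRep_gen {n k : ℕ} (i : ℕ) (hk : k ≤ n) : cupRep n i (gen n k) = cupOp i k := by
  rw [gen, dif_pos hk, cupRep_E]

theorem cupRep_apply_of_cupOp_eq_zero {n i : ℕ} {y : CupState →₀ K}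
    (hy : ∀ k ≤ n, cupOp i k y = 0) (x : TLD n) : cupRep n i x y = aug n x • y := by
  induction x using induction_on with
  | one => simp
  | mul k z hz =>
    rw [map_mul, Module.End.mul_apply, hz, map_smul, cupRep_E, hy k (Nat.le_of_lt_succ k.2),
      map_mul, aug_E, zero_mul, zero_smul, smul_zero]
  | add z w hz hw => rw [map_add, LinearMap.add_apply, hz, hw, map_add, add_smul]
  | smul r z hz => rw [map_smul, LinearMap.smul_apply, hz, map_smul, smul_assoc]

/-- The right side is killed by all generators, hence fixed by `Q`; all its terms but `v` are killed
by `Q`. -/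
theorem cupRep_apply_v_of_E_mul {n i : ℕ} {Q : TLD n} (hQ' : ∀ k, Q * E n k = 0)
    (h1 : aug n Q = 1) (hi1 : 1 ≤ i) (hi : i ≤ n) :
    cupRep n i Q (single v 1) = single v 1 +
      ∑ j ∈ Finset.range (n + 1), solB n i j • single (b j) (1 : K) +
      ∑ j ∈ Finset.Icc 1 n, solC n i j • single (c j) (1 : K) := by
  set u : CupState →₀ K := single v 1 +
      ∑ j ∈ Finset.range (n + 1), solB n i j • single (b j) (1 : K) +
      ∑ j ∈ Finset.Icc 1 n, solC n i j • single (c j) (1 : K) with hu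
  have hu0 : ∀ k ≤ n, cupOp i k u = 0 := fun k hk =>
    apply_solution_eq_zero hi1 hi hk (cupOp i k) (single v 1) (fun j => single (b j) 1)
      (fun j => single (c j) 1) (cupOp_single i k v) (fun j _ => cupOp_single i k (b j))
      (fun j _ _ => cupOp_single i k (c j))
  -- An eigenvector with eigenvalue `-[2] ≠ 0` is in the image of the generator, and `Q * E n k =
  -- 0`.
  have hkill : ∀ k ≤ n, ∀ y : CupState →₀ K, cupOp i k y = (-qint 2) • y →
      cupRep n i Q y = 0 := by
    intro k hk y hy
    have h2 : cupRep n i Q (cupOp i k y) = 0 := by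
      rw [← cupRep_gen i hk, ← Module.End.mul_apply, ← map_mul, gen, dif_pos hk, hQ', map_zero,
        LinearMap.zero_apply]
    rw [hy, map_smul] at h2
    exact (smul_eq_zero.1 h2).resolve_left (neg_ne_zero.2 qint_two_ne_zero)
  have hQu := cupRep_apply_of_cupOp_eq_zero hu0 Q
  rw [h1, one_smul] at hQu
  rw [← hQu, hu, map_add, map_add, map_sum, map_sum, Finset.sum_eq_zero, Finset.sum_eq_zero,
    add_zero, add_zero]
  · intro j hj
    rw [Finset.mem_Icc] at hj
    rw [map_smul, hkill j hj.2 _ (by simpa [hj.1] using cupOp_c_self i j), smul_zero]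
  · intro j hj
    rw [Finset.mem_range] at hj
    rw [map_smul, hkill j (by omega) _ (cupOp_b_self i j), smul_zero]

/-- The functional giving the coefficient of `cupC (gen n) i j`. -/
def cupCoeff (n i j : ℕ) : TLD n →ₗ[K] K :=
  Finsupp.lapply (c j) ∘ₗ LinearMap.applyₗ (single v 1) ∘ₗ (cupRep n i).toLinearMap

theorem cupCoeff_apply (n i j : ℕ) (x : TLD n) :
    cupCoeff n i j x = cupRep n i x (single v 1) (c j) := rfl

theorem cupCoeff_projection {n i j : ℕ} {Q : TLD n} (hQ' : ∀ k, Q * E n k = 0)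
    (h1 : aug n Q = 1) (hi1 : 1 ≤ i) (hi : i ≤ n) (hj1 : 1 ≤ j) (hj : j ≤ n) :
    cupCoeff n i j Q = solC n i j := by
  rw [cupCoeff_apply, cupRep_apply_v_of_E_mul hQ' h1 hi1 hi]
  simp only [Finsupp.add_apply, Finsupp.finsetSum_apply, Finsupp.smul_apply]
  rw [Finsupp.single_eq_of_ne (by simp), Finset.sum_eq_zero, Finset.sum_eq_single j]
  · simp
  · intro l _ hl
    rw [Finsupp.single_eq_of_ne (by simpa using hl.symm), smul_zero]
  · intro h
    exact absurd (Finset.mem_Icc.2 ⟨hj1, hj⟩) h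
  · intro l _
    rw [Finsupp.single_eq_of_ne (by simp), smul_zero]

theorem cupRep_cupB_apply_v {n i j : ℕ} (hi : i ≤ n) (hj : 1 ≤ j) (hji : j ≤ i) :
    cupRep n i (cupB (gen n) i j) (single v 1) = single (b j) 1 := by
  induction hd : i - j generalizing j with
  | zero =>
    obtain rfl : j = i := by omega
    rw [cupB_self _ hj, cupRep_gen _ hi, cupOp_single, cupAct, if_pos (by omega)]
  | succ d ih =>
    rw [cupB_eq_mul_succ _ hj (by omega), map_mul, Module.End.mul_apply,
      ih (by omega) (by omega) (by omega), cupRep_gen _ (by omega),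
      cupOp_b_of_adj (by unfold DynkinAdj; omega)]

theorem cupRep_cupC_apply_v {n i j : ℕ} (hi1 : 1 ≤ i) (hi : i ≤ n) (hj1 : 1 ≤ j) (hj : j ≤ n) :
    cupRep n i (cupC (gen n) i j) (single v 1) = single (c j) 1 := by
  induction j, hj1 using Nat.le_induction with
  | base =>
    have h0 : cupRep n i (gen n 0 * asc (gen n) 2 (i - 1)) (single v 1) = single (b 0) 1 := by
      rw [map_mul, Module.End.mul_apply, cupRep_gen _ (by omega)]
      rcases Nat.eq_or_lt_of_le hi1 with rfl | h
      · rw [Nat.sub_self, asc, map_one, Module.End.one_apply, cupOp_single, cupAct,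
          if_pos (by omega)]
      · have h2 : asc (gen n) 2 (i - 1) = cupB (gen n) i 2 := by
          rw [cupB, if_neg (by omega), if_pos (by omega), show i + 1 - 2 = i - 1 by omega]
        rw [h2, cupRep_cupB_apply_v hi (by omega) (by omega),
          cupOp_b_of_adj (by unfold DynkinAdj; omega)]
    rw [cupC, map_mul, Module.End.mul_apply, h0, cupRep_gen _ (by omega),
      cupOp_b_of_add_eq_one rfl]
  | succ j hj1 ih =>
    rw [cupC_succ _ _ hj1, map_mul, Module.End.mul_apply, ih (by omega), cupRep_gen _ hj,
      cupOp_c_of_adj (by omega), show max (j + 1) 1 = j + 1 by omega]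

/-! ### Reduced words and coefficients -/

/-- The involution of the Dynkin diagram that exchanges the nodes `0` and `1`. -/
def flip (k : ℕ) : ℕ := if k = 0 then 1 else if k = 1 then 0 else k

theorem flip_flip (k : ℕ) : flip (flip k) = k := by
  unfold flip; grind

theorem dynkinAdj_flip {k j : ℕ} : DynkinAdj (flip k) (flip j) ↔ DynkinAdj k j := by
  unfold DynkinAdj flip; grind

theorem flip_le {n k : ℕ} (hn : 1 ≤ n) (hk : k ≤ n) : flip k ≤ n := by
  unfold flip; split_ifs <;> omega

namespace TLFamily

variable {A : Type*} [Ring A] [Algebra K A] {n : ℕ} {e : ℕ → A}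

theorem comp_flip (h : TLFamily n e) (hn : 1 ≤ n) : TLFamily n (e ∘ flip) where
  sq _ hk := h.sq _ (flip_le hn hk)
  braid _ hk _ hj hkj := h.braid _ (flip_le hn hk) _ (flip_le hn hj) (dynkinAdj_flip.2 hkj)
  comm _ hk _ hj hkj :=
    h.comm _ (flip_le hn hk) _ (flip_le hn hj) fun h' => hkj (dynkinAdj_flip.1 h')

/-- For end node `1`, `v` is moved by both `E_0` and `E_1`, so a vector `b_j` may come from two
different monomials, exchanged by `flip`. They merge once a `c_j` is reached, because `e_0` and
`e_1` commute. -/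
theorem cupC_comp_flip (h : TLFamily n e) (hn : 1 ≤ n) {j : ℕ} (hj : 1 ≤ j) :
    cupC (e ∘ flip) 1 j = cupC e 1 j := by
  induction j, hj using Nat.le_induction with
  | base =>
    have h01 : e 0 * e 1 = e 1 * e 0 :=
      h.comm 0 (by omega) 1 hn (by unfold DynkinAdj; omega)
    simp [cupC, asc, flip, h01]
  | succ j hj ih =>
    rw [cupC_succ _ _ hj, cupC_succ _ _ hj, ih, Function.comp_apply, flip, if_neg (by omega),
      if_neg (by omega)]

end TLFamily

/-- `x` is the one-cup monomial of a path from `j` to the end node `i`, or to the node `0` if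
`i = 1`. -/
def IsCup (n i j : ℕ) (x : TLD n) : Prop :=
  (x = cupB (gen n) i j ∧ (j = 0 → 2 ≤ n)) ∨
    (i = 1 ∧ x = cupB (gen n ∘ flip) 1 (flip j) ∧ (flip j = 0 → 2 ≤ n))

theorem isCup_gen {n i k : ℕ} (hk : max k 1 = i) : IsCup n i k (gen n k) := by
  rcases Nat.eq_zero_or_pos k with rfl | hk0
  · refine Or.inr ⟨hk.symm, ?_, fun h => absurd h one_ne_zero⟩
    rw [show flip 0 = 1 from rfl, cupB_self _ le_rfl]
    rfl
  · obtain rfl : k = i := by omega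
    exact Or.inl ⟨(cupB_self _ hk0).symm, by omega⟩

namespace IsCup

variable {n i j : ℕ} {x : TLD n}

theorem gen_mul_self (hx : IsCup n i j x) (hi1 : 1 ≤ i) (hi : i ≤ n) (hj : j ≤ n) :
    gen n j * x = (-qint 2) • x := by
  have hn := hi1.trans hi
  rcases hx with ⟨rfl, _⟩ | ⟨rfl, rfl, _⟩
  · exact (tlFamily_gen n).mul_cupB_self hi1 hj
  · have h := ((tlFamily_gen n).comp_flip hn).mul_cupB_self le_rfl (flip_le hn hj)
    rwa [Function.comp_apply, flip_flip] at h

theorem gen_mul_of_adj (hx : IsCup n i j x) (hi1 : 1 ≤ i) (hi : i ≤ n) (hj : j ≤ n) {k : ℕ}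
    (hk : k ≤ n) (hkj : DynkinAdj k j) : IsCup n i k (gen n k * x) := by
  have hn := hi1.trans hi
  have h2 : k ≤ 1 → 2 ≤ n := by unfold DynkinAdj at hkj; omega
  rcases hx with ⟨rfl, _⟩ | ⟨rfl, rfl, _⟩
  · exact Or.inl ⟨(tlFamily_gen n).mul_cupB_of_adj hi1 hj hk hkj, fun h => h2 (by omega)⟩
  · have h := ((tlFamily_gen n).comp_flip hn).mul_cupB_of_adj le_rfl (flip_le hn hj)
      (flip_le hn hk) (dynkinAdj_flip.2 hkj)
    rw [Function.comp_apply, flip_flip] at h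
    exact Or.inr ⟨rfl, h, fun h' => h2 (by unfold flip at h'; split_ifs at h' <;> omega)⟩

theorem gen_mul_of_add_eq_one (hx : IsCup n i j x) (hi1 : 1 ≤ i) (hi : i ≤ n) {k : ℕ}
    (hkj : k + j = 1) : gen n k * x = cupC (gen n) i 1 := by
  have hn := hi1.trans hi
  rcases hx with ⟨rfl, h0⟩ | ⟨rfl, rfl, h0⟩
  · exact (tlFamily_gen n).mul_cupB_of_add_eq_one hi1 hi hkj h0
  · have h := ((tlFamily_gen n).comp_flip hn).mul_cupB_of_add_eq_one le_rfl hn (k := flip k)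
      (by unfold flip; split_ifs <;> omega) h0
    rwa [Function.comp_apply, flip_flip, (tlFamily_gen n).cupC_comp_flip hn le_rfl] at h

end IsCup


/-- The word `w` acts on the one-cup module by sending the vector `v` to the multiple `s` of the
basis vector with the given label. The length of `w` is then bounded below. -/
def Reaches (n i : ℕ) (w : List (Fin (n + 1))) (s : K) : CupState → Prop
  | v => w = [] ∧ s = 1
  | b j => j ≤ n ∧ (∃ x, IsCup n i j x ∧ word n w = s • x) ∧
      (max j 1 - i) + (i - max j 1) + 1 ≤ w.length ∧
      (w.length = (max j 1 - i) + (i - max j 1) + 1 → s = 1)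
  | c j => 1 ≤ j ∧ j ≤ n ∧ word n w = s • cupC (gen n) i j ∧ i + j ≤ w.length ∧
      (w.length = i + j → s = 1)

theorem word_nil (n : ℕ) : word n [] = 1 := rfl

theorem word_cons (n : ℕ) (k : Fin (n + 1)) (w : List (Fin (n + 1))) :
    word n (k :: w) = gen n k * word n w := by
  rw [gen_val, word, word, List.map_cons, List.prod_cons]

/-- Each transition of `cupAct` mirrors an identity of monomials in the algebra. The length bound
grows by at most one per letter, and not at all when a factor `-[2]` appears; a word of minimal
length therefore carries the scalar `1`. -/
theorem reaches_cons {n i : ℕ} (hi1 : 1 ≤ i) (hi : i ≤ n) {w : List (Fin (n + 1))} {s : K}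
    {t : CupState} (h : Reaches n i w s t) (k : Fin (n + 1)) :
    s • cupAct i k t = 0 ∨ ∃ s' t', s • cupAct i k t = s' • single t' 1 ∧
      Reaches n i (k :: w) s' t' := by
  have hk : (k : ℕ) ≤ n := Nat.le_of_lt_succ k.2
  have hl : (k :: w).length = w.length + 1 := rfl
  rw [← cupOp_single]
  cases t with
  | v =>
    obtain ⟨rfl, rfl⟩ := h
    rw [cupOp_single, cupAct]
    split_ifs with h1
    · refine Or.inr ⟨1, b k, rfl, hk, ⟨gen n k, isCup_gen h1, ?_⟩, ?_, fun _ => rfl⟩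
      · rw [word_cons, word_nil, mul_one, one_smul]
      · rw [hl, List.length_nil]; omega
    · exact Or.inl (smul_zero _)
  | b j =>
    obtain ⟨hj, ⟨x, hx, hw⟩, hlen, hs⟩ := h
    by_cases h1 : j = k
    · subst h1
      refine Or.inr ⟨s * -qint 2, b k, ?_, hk, ⟨x, hx, ?_⟩, ?_, fun h => ?_⟩
      · rw [cupOp_b_self, smul_smul]
      · rw [word_cons, hw, mul_smul_comm, hx.gen_mul_self hi1 hi hj, smul_smul]
      · omega
      · omega
    by_cases h2 : DynkinAdj k j
    · refine Or.inr ⟨s, b k, ?_, hk, ⟨_, hx.gen_mul_of_adj hi1 hi hj hk h2, ?_⟩, ?_,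
        fun h => hs ?_⟩
      · rw [cupOp_b_of_adj h2]
      · rw [word_cons, hw, mul_smul_comm]
      · unfold DynkinAdj at h2; omega
      · unfold DynkinAdj at h2; omega
    by_cases h3 : k + j = 1
    · refine Or.inr ⟨s, c 1, ?_, le_rfl, hi1.trans hi, ?_, ?_, fun h => hs ?_⟩
      · rw [cupOp_b_of_add_eq_one h3]
      · rw [word_cons, hw, mul_smul_comm, hx.gen_mul_of_add_eq_one hi1 hi h3]
      · omega
      · omega
    · exact Or.inl (by rw [cupOp_b_eq_zero h1 h2 h3, smul_zero])
  | c j =>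
    obtain ⟨hj1, hj, hw, hlen, hs⟩ := h
    by_cases h1 : j = max (k : ℕ) 1
    · refine Or.inr ⟨s * -qint 2, c j, ?_, hj1, hj, ?_, ?_, fun h => ?_⟩
      · rw [h1, cupOp_c_self, smul_smul]
      · rw [word_cons, hw, mul_smul_comm, (tlFamily_gen n).mul_cupC_self hj hj1 h1.symm, smul_smul]
      · omega
      · omega
    by_cases h2 : j = max (k : ℕ) 1 + 1 ∨ max (k : ℕ) 1 = j + 1
    · refine Or.inr ⟨s, c (max k 1), ?_, by omega, by omega, ?_, ?_, fun h => hs ?_⟩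
      · rw [cupOp_c_of_adj h2]
      · rw [word_cons, hw, mul_smul_comm, (tlFamily_gen n).mul_cupC_of_adj hj hj1 hk h2]
      · omega
      · omega
    · exact Or.inl (by rw [cupOp_c_eq_zero h1 h2, smul_zero])

theorem exists_reaches {n i : ℕ} (hi1 : 1 ≤ i) (hi : i ≤ n) (w : List (Fin (n + 1))) :
    cupRep n i (word n w) (single v 1) = 0 ∨
      ∃ s t, cupRep n i (word n w) (single v 1) = s • single t 1 ∧ Reaches n i w s t := by
  induction w with
  | nil => exact Or.inr ⟨1, v, by rw [word_nil, map_one, one_smul]; rfl, rfl, rfl⟩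
  | cons k w ih =>
    rw [word_cons, map_mul, Module.End.mul_apply, cupRep_gen _ (Nat.le_of_lt_succ k.2)]
    rcases ih with h | ⟨s, t, h, hr⟩
    · exact Or.inl (by rw [h, map_zero])
    · rw [h, map_smul, cupOp_single]
      exact reaches_cons hi1 hi hr k

theorem reaches_of_cupCoeff_ne_zero {n i j : ℕ} (hi1 : 1 ≤ i) (hi : i ≤ n)
    {w : List (Fin (n + 1))} (h : cupCoeff n i j (word n w) ≠ 0) :
    Reaches n i w (cupCoeff n i j (word n w)) (c j) := by
  rw [cupCoeff_apply] at *
  rcases exists_reaches hi1 hi w with h0 | ⟨s, t, h0, hr⟩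
  · rw [h0] at h
    exact absurd rfl h
  · rw [h0, Finsupp.smul_apply] at h ⊢
    by_cases ht : t = c j
    · subst ht
      rwa [Finsupp.single_eq_same, smul_eq_mul, mul_one]
    · rw [Finsupp.single_eq_of_ne (Ne.symm ht), smul_zero] at h
      exact absurd rfl h

/-! ### Spanning by reduced words, and extraction of the coefficient -/

theorem word_mem_span (n : ℕ) (w : List (Fin (n + 1))) :
    word n w ∈ Submodule.span K (monomials n) := by
  induction hl : w.length using Nat.strong_induction_on generalizing w with
  | _ l ih =>
    by_cases hr : IsReduced n w
    · exact Submodule.subset_span ⟨w, hr, rfl⟩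
    · unfold IsReduced at hr
      push Not at hr
      obtain ⟨w', r, hw, hlt⟩ := hr
      rw [hw]
      exact Submodule.smul_mem _ _ (ih _ (hl ▸ hlt) w' rfl)

theorem mem_span_monomials (n : ℕ) (x : TLD n) : x ∈ Submodule.span K (monomials n) := by
  have h : ∀ x : TLD n, x ∈ Submodule.span K (Set.range (word n)) := by
    intro x
    induction x using induction_on with
    | one => exact Submodule.subset_span ⟨[], rfl⟩
    | mul k y hy =>
      induction hy using Submodule.span_induction with
      | mem y hy =>
        obtain ⟨w, rfl⟩ := hy
        exact Submodule.subset_span ⟨k :: w, by rw [word_cons, gen_val]⟩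
      | zero => rw [mul_zero]; exact Submodule.zero_mem _
      | add y z _ _ hy hz => rw [mul_add]; exact Submodule.add_mem _ hy hz
      | smul r y _ hy => rw [mul_smul_comm]; exact Submodule.smul_mem _ _ hy
    | add y z hy hz => exact Submodule.add_mem _ hy hz
    | smul r y hy => exact Submodule.smul_mem _ _ hy
  refine Submodule.span_le.2 ?_ (h x)
  rintro _ ⟨w, rfl⟩
  exact word_mem_span n w

theorem hasCoeff_solC {n i j : ℕ} (hi1 : 1 ≤ i) (hi : i ≤ n) (hj1 : 1 ≤ j) (hj : j ≤ n)
    {Q : ∀ n, TLD n} (hQ : IsJonesWenzl Q) {d : List (Fin (n + 1))}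
    (hd : word n d = cupC (gen n) i j) (hlen : d.length = i + j) :
    HasCoeff n (Q n) (word n d) (solC n i j) := by
  have hone : cupCoeff n i j (word n d) = 1 := by
    rw [cupCoeff_apply, hd, cupRep_cupC_apply_v hi1 hi hj1 hj, Finsupp.single_eq_same]
  -- The functional is nonzero on any word proportional to `d` in this way, which forces its length
  -- to be at least `i + j`.
  have hred : IsReduced n d := by
    intro w r hw
    have hne : cupCoeff n i j (word n w) ≠ 0 := by
      intro h
      rw [hw, map_smul, h, smul_zero] at hone
      exact zero_ne_one hone
    have h := (reaches_of_cupCoeff_ne_zero hi1 hi hne).2.2.2.1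
    omega
  refine ⟨⟨d, hred, rfl⟩, mem_span_monomials n _, fun f hf hsum => ?_⟩
  have hother : ∀ x ∈ monomials n, x ≠ word n d → cupCoeff n i j x = 0 := by
    rintro _ ⟨w, hw, rfl⟩ hne
    by_contra h0
    -- Such a reduced word is a multiple of `D`, so it is no longer than `d`; its length is then
    -- exactly `i + j`, and the scalar is `1`.
    obtain ⟨-, -, h1, h2, h3⟩ := reaches_of_cupCoeff_ne_zero hi1 hi h0
    rw [← hd] at h1
    have hle := hw d _ h1
    rw [h3 (by omega), one_smul] at h1
    exact hne h1
  rw [← cupCoeff_projection (hQ.mul_E n) (hQ.aug_eq_one n) hi1 hi hj1 hj, ← hsum, Finsupp.sum,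
    map_sum, Finset.sum_eq_single (word n d)]
  · rw [map_smul, hone, smul_eq_mul, mul_one]
  · intro x hx hne
    rw [map_smul, hother x (hf x hx) hne, smul_zero]
  · intro h
    rw [Finsupp.notMem_support_iff.1 h, zero_smul, map_zero]

/-! ### The words of the proposition -/

theorem word_eq_prod_gen (n : ℕ) (w : List (Fin (n + 1))) :
    word n w = ((w.map Fin.val).map (gen n)).prod := by
  rw [word, List.map_map]
  congr 2
  exact funext fun k => (gen_val n k).symm

theorem filter_range_eq_range' {N a m : ℕ} (h : a + m ≤ N) :
    (List.range N).filter (fun k => a ≤ k ∧ k < a + m) = List.range' a m := by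
  obtain ⟨r, rfl⟩ : ∃ r, N = a + (m + r) := ⟨N - a - m, by omega⟩
  rw [List.range_eq_range', ← List.range'_append_1, ← List.range'_append_1, List.filter_append,
    List.filter_append, List.filter_eq_nil_iff.2, List.filter_eq_self.2, List.filter_eq_nil_iff.2,
    List.nil_append, List.append_nil, Nat.zero_add]
  all_goals
    intro k hk
    rw [List.mem_range'_1] at hk
    simp
    omega

theorem map_val_filter_finRange {n a l : ℕ} (ha : a ≤ l + 1) (hl : l ≤ n) :
    ((List.finRange (n + 1)).filter fun k => a ≤ k.val ∧ k.val ≤ l).map Fin.val =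
      List.range' a (l + 1 - a) := by
  rw [← filter_range_eq_range' (N := n + 1) (a := a) (m := l + 1 - a) (by omega),
    ← List.map_coe_finRange_eq_range, List.filter_map]
  congr 2
  funext k
  simp only [Function.comp_apply, decide_eq_decide]
  omega

theorem map_val_wordD {n i j : ℕ} (hj : j ≤ n) (hi : i ≤ n) (hi1 : 1 ≤ i) :
    (wordD n j i).map Fin.val = (List.range' 1 j).reverse ++ 0 :: List.range' 2 (i - 1) := by
  rw [wordD, List.map_append, List.map_reverse, List.map_cons,
    map_val_filter_finRange (by omega) hj, map_val_filter_finRange (by omega) hi,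
    Nat.add_sub_cancel, show i + 1 - 2 = i - 1 by omega]
  rfl

theorem prod_map_range' {A : Type*} [Ring A] (e : ℕ → A) (j m : ℕ) :
    ((List.range' j m).map e).prod = asc e j m := by
  induction m generalizing j with
  | zero => rfl
  | succ m ih => rw [List.range'_succ, List.map_cons, List.prod_cons, ih, asc]

theorem prod_map_reverse_range' {A : Type*} [Ring A] (e : ℕ → A) (a : ℕ) {j : ℕ} (hj : 1 ≤ j) :
    (((List.range' 1 j).reverse).map e).prod * (e 0 * asc e 2 (a - 1)) = cupC e a j := by
  induction j, hj using Nat.le_induction with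
  | base => simp [cupC]
  | succ j hj ih =>
    rw [List.range'_1_concat, List.reverse_append, List.map_append, List.prod_append, mul_assoc, ih,
      cupC_succ e a hj, add_comm 1 j]
    simp

theorem word_wordD {n i j : ℕ} (hj1 : 1 ≤ j) (hj : j ≤ n) (hi1 : 1 ≤ i) (hi : i ≤ n) :
    word n (wordD n j i) = cupC (gen n) i j := by
  rw [word_eq_prod_gen, map_val_wordD hj hi hi1, List.map_append, List.prod_append, List.map_cons,
    List.prod_cons, prod_map_range', prod_map_reverse_range' _ _ hj1]

theorem length_wordD {n i j : ℕ} (hj : j ≤ n) (hi1 : 1 ≤ i) (hi : i ≤ n) :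
    (wordD n j i).length = i + j := by
  rw [← List.length_map (f := Fin.val), map_val_wordD hj hi hi1]
  simp
  omega

/-- Expand the fraction by `[n]` and use `[2n] = [n] (q^n + q^(-n))`. -/
theorem solC_eq {n : ℕ} (hn : 1 ≤ n) (i j : ℕ) :
    solC n i j = qint n * qint ((n : ℤ) + 1 - i) * qint ((n : ℤ) + 1 - j) /
      (qint (2 * (n : ℤ)) * qint ((n : ℤ) + 1)) := by
  have hW : qsum n ≠ 0 := qsum_ne_zero (by omega)
  have h1 : qint n ≠ 0 := qint_ne_zero (by omega)
  have h2 : qint ((n : ℤ) + 1) ≠ 0 := by exact_mod_cast qint_ne_zero (m := n + 1) (by omega)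
  rw [solC, qint_two_mul]
  field_simp

end TLTypeD

end

theorem mainTheorem9 :
    (∃! Q : ∀ n : ℕ, TLTypeD.TLD n, TLTypeD.IsJonesWenzl Q) ∧
    ∀ Q : ∀ n : ℕ, TLTypeD.TLD n, TLTypeD.IsJonesWenzl Q →
      (∀ n i j : ℕ, 1 ≤ j → j ≤ n → 2 ≤ i → i ≤ n →
        TLTypeD.HasCoeff n (Q n) (TLTypeD.word n (TLTypeD.wordD n j i))
          (TLTypeD.qint n * TLTypeD.qint ((n : ℤ) + 1 - i) * TLTypeD.qint ((n : ℤ) + 1 - j) /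
            (TLTypeD.qint (2 * (n : ℤ)) * TLTypeD.qint ((n : ℤ) + 1)))) ∧
      (∀ (n : ℕ) (hn : 1 ≤ n),
        TLTypeD.HasCoeff n (Q n) (TLTypeD.E n 0 * TLTypeD.E n ⟨1, Nat.succ_lt_succ hn⟩)
          (TLTypeD.qint n ^ 3 /
            (TLTypeD.qint (2 * (n : ℤ)) * TLTypeD.qint ((n : ℤ) + 1)))) := by
  refine ⟨?_, fun Q hQ => ⟨fun n i j hj1 hj hi2 hi => ?_, fun n hn => ?_⟩⟩
  · obtain ⟨Q, hQ⟩ := TLTypeD.exists_isJonesWenzl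
    exact ⟨Q, hQ, fun Q' hQ' => hQ'.unique hQ⟩
  · have hi1 : 1 ≤ i := by omega
    rw [← TLTypeD.solC_eq (hj1.trans hj)]
    exact TLTypeD.hasCoeff_solC hi1 hi hj1 hj hQ (TLTypeD.word_wordD hj1 hj hi1 hi)
      (TLTypeD.length_wordD hj hi1 hi)
  · have hs := TLTypeD.solC_eq hn 1 1
    -- For `i = j = 1` the ascending tail is empty and the word is `E_1 E_0`, which equals `E_0
    -- E_1`.
    have hw := TLTypeD.word_wordD le_rfl hn le_rfl hn
    have hE : TLTypeD.E n 0 * TLTypeD.E n ⟨1, Nat.succ_lt_succ hn⟩ =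
        TLTypeD.word n (TLTypeD.wordD n 1 1) := by
      have h0 : TLTypeD.gen n 0 = TLTypeD.E n 0 := TLTypeD.gen_val n 0
      have h1 : TLTypeD.gen n 1 = TLTypeD.E n ⟨1, Nat.succ_lt_succ hn⟩ := dif_pos hn
      rw [hw, TLTypeD.cupC, Nat.sub_self, TLTypeD.asc, mul_one, h0, h1]
      exact TLTypeD.E_comm n _ _ (by unfold TLTypeD.DynkinAdj; simp)
    rw [hE]
    convert TLTypeD.hasCoeff_solC le_rfl hn le_rfl hn hQ hw (TLTypeD.length_wordD hn le_rfl hn)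
      using 1
    rw [hs, Nat.cast_one, add_sub_cancel_right]
    ring
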